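/- Let $\rho=e^{2\pi i/3}$ and let $\overline{\,\cdot\,}$ denote complex conjugation. Let $\ell$ be a prime number with $\ell\equiv 4$ or $7 \pmod 9$, and let $\lambda\in\mathbb Z[\rho]$ satisfy $\lambda\overline{\lambda}=\ell$ and $\lambda\equiv 1\pmod 3$. Let $\chi_\lambda$ be the cubic residue character modulo $\lambda$: for $\lambda\nmid\nu$, $\chi_\lambda(\nu)\in\{1,\rho,\overline\rho\}$ and $\chi_\lambda(\nu)\equiv\nu^{(\ell-1)/3}\pmod\lambda$. Let $\chi_0:(\mathbb Z[\rho]/(3))^\times\to\{\pm1,\pm\rho,\pm\overline\rho\}$ and $\chi_0':(\mathbb Z[\rho]/(\sqrt{-3}))^\times\to\{\pm1\}$ be the natural isomorphisms (each class is sent to the element of the target that it contains). All three are extended by zero to $\mathbb Z[\rho]$. Put $\chi_1=\chi_\lambda\overline{\chi_0}$ if $\ell\equiv7\pmod 9$ and $\chi_1=\chi_\lambda\chi_0'$ if $\ell\equiv4\pmod 9$. Then $\widetilde{\chi_\lambda}((\nu)):=\chi_1(\nu)\overline{\nu}$ does not depend on the generator $\nu$ of the ideal $(\nu)$. For $\psi=\widetilde{\chi_\lambda}$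 or $\psi=\overline{\widetilde{\chi_\lambda}}$ let $$L(s,\psi)=\prod_{\mathfrak p}\bigl(1-\psi(\mathfrak p)\,(N\mathfrak p)^{-s}\bigr)^{-1},$$ where $\mathfrak p$ runs over the nonzero prime ideals of $\mathbb Z[\rho]$ and $N\mathfrak p=\#(\mathbb Z[\rho]/\mathfrak p)$. Let $\mathcal E_\lambda: y^2=x^3+\lambda^2/4$ over $\mathbb Q(\rho)$, and let $$L(\mathcal E_\lambda/\mathbb Q(\rho),s)=\prod_{\mathfrak p}L_{\mathfrak p}\bigl((N\mathfrak p)^{-s}\bigr)^{-1},$$ where $L_{\mathfrak p}(T)=1-a_{\mathfrak p}T+N\mathfrak p\,T^2$ with $a_{\mathfrak p}=N\mathfrak p+1-\#\mathcal E_\lambda(\mathbb Z[\rho]/\mathfrak p)$ (points on the reduction of a minimal Weierstrass model at $\mathfrak p$) if $\mathcal E_\lambda$ has good reduction at $\mathfrak p$, and $L_{\mathfrak p}(T)=1-T$, $1+T$, $1$ if the reduction is split multiplicative, non-split multiplicative, additive, respectively. Then the three products converge unconditionally for $\operatorname{Re}s>3/2$, and $$L(s,\widetilde{\chi_\lambda})\,L(s,\overline{\widetilde{\chi_\lambda}})=L(\mathcal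 E_\lambda/\mathbb Q(\rho),s)$$ there. The same identity holds for analytic continuations: if $U$ is a connected open set containing this half-plane and the three functions extend holomorphically to $U$, then the identity holds on all of $U$. -/

import Mathlib

open IsDedekindDomain NumberField

noncomputable section

namespace EisensteinCurve

/-- The cube root of unity `ρ = e^{2πi/3}`. -/
def rho : ℂ := Complex.exp (2 * Real.pi * Complex.I / 3)

/-- The field `ℚ(ρ)`, as a subfield of `ℂ`. -/
abbrev K : IntermediateField ℚ ℂ := IntermediateField.adjoin ℚ {rho}

theorem isPrimitiveRoot_rho : IsPrimitiveRoot rho 3 := by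
  have h := Complex.isPrimitiveRoot_exp 3 (by norm_num)
  simpa [rho] using h

instance isCyclotomicExtension_K : IsCyclotomicExtension {3} ℚ K :=
  (IntermediateField.isCyclotomicExtension_singleton_iff_eq_adjoin 3 _ _ K isPrimitiveRoot_rho).2 rfl

instance numberField_K : NumberField K := IsCyclotomicExtension.numberField {3} ℚ K

instance isPrincipalIdealRing_K : IsPrincipalIdealRing (𝓞 K) :=
  IsCyclotomicExtension.Rat.three_pid K

/-- The complex number underlying an element of `ℤ[ρ] = 𝓞 ℚ(ρ)`. -/
def toC (x : 𝓞 K) : ℂ := ((x : K) : ℂ)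

/-- `ρ` as an element of `ℤ[ρ]`. -/
def rhoInt : 𝓞 K :=
  ⟨⟨rho, IntermediateField.mem_adjoin_simple_self ℚ rho⟩, by
    refine ⟨Polynomial.X ^ 3 - 1, Polynomial.monic_X_pow_sub_C 1 (by norm_num), ?_⟩
    have h : (⟨rho, IntermediateField.mem_adjoin_simple_self ℚ rho⟩ : K) ^ 3 = 1 :=
      Subtype.ext isPrimitiveRoot_rho.pow_eq_one
    simp [h]⟩

/-- The element of `S` congruent to `a` modulo `m`, or `0` if there is none. It is only used for
finite sets `S` whose elements are pairwise incongruent modulo `m`. -/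
def residueRep (S : Set (𝓞 K)) (m a : 𝓞 K) : 𝓞 K :=
  open Classical in if h : ∃ w ∈ S, m ∣ a - w then h.choose else 0

/-- The cubic residue character `χ_λ` modulo a prime `lam` of prime norm `l`: the cube root of unity
congruent to `ν ^ ((l - 1) / 3)` modulo `lam`, and `0` if `lam` divides `ν`. -/
def chiLam (l : ℕ) (lam ν : 𝓞 K) : ℂ :=
  toC (residueRep {w | w ^ 3 = 1} lam (ν ^ ((l - 1) / 3)))

/-- The natural isomorphism `χ₀ : (ℤ[ρ]/(3))ˣ ≃ {±1, ±ρ, ±ρ²}`, extended by zero. -/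
def chiZero (ν : 𝓞 K) : ℂ := toC (residueRep {w | w ^ 6 = 1} 3 ν)

/-- The natural isomorphism `χ₀' : (ℤ[ρ]/(√-3))ˣ ≃ {±1}`, extended by zero; `√-3 = 1 + 2ρ`. -/
def chiZero' (ν : 𝓞 K) : ℂ := toC (residueRep {1, -1} (1 + 2 * rhoInt) ν)

/-- The character `χ₁`, for `l ≡ 7` or `l ≡ 4` modulo `9`. -/
def chiOne (l : ℕ) (lam ν : 𝓞 K) : ℂ :=
  if l % 9 = 7 then chiLam l lam ν * starRingEnd ℂ (chiZero ν)
  else if l % 9 = 4 then chiLam l lam ν * chiZero' ν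
  else 0

/-- The Hecke character `(ν) ↦ χ₁(ν) ν̄` on the ideals of `ℤ[ρ]`, computed on a generator. -/
def heckeChar (l : ℕ) (lam : 𝓞 K) (I : Ideal (𝓞 K)) : ℂ :=
  chiOne l lam (Submodule.IsPrincipal.generator I) *
    starRingEnd ℂ (toC (Submodule.IsPrincipal.generator I))

/-- The local factor at `P` of the Hecke `L`-series of a function `ψ` on ideals. -/
def heckeFactor (ψ : Ideal (𝓞 K) → ℂ) (s : ℂ) (P : HeightOneSpectrum (𝓞 K)) : ℂ :=
  (1 - ψ P.asIdeal * (Ideal.absNorm P.asIdeal : ℂ) ^ (-s))⁻¹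

/-- The Hecke `L`-series, as an Euler product over all nonzero primes. -/
def heckeL (ψ : Ideal (𝓞 K) → ℂ) (s : ℂ) : ℂ := ∏' P, heckeFactor ψ s P

/-- The curve `E_λ : y² = x³ + λ²/4` over `ℚ(ρ)`. -/
def curve (lam : 𝓞 K) : WeierstrassCurve K := ⟨0, 0, 0, 0, (lam : K) ^ 2 / 4⟩

/-- The local factor `L_P(E/ℚ(ρ), q_P^{-s})⁻¹` of the `L`-function of `E/ℚ(ρ)`. The local polynomial
is that of the minimal model over the completion at `P`: it is `1 - a T + q T²` with
`a = q + 1 - #E(k_P)` for good reduction, and `1 - T`, `1 + T`, `1` for split multiplicative,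
non-split multiplicative and additive reduction. -/
def ellipticFactor (E : WeierstrassCurve K) (s : ℂ) (P : HeightOneSpectrum (𝓞 K)) : ℂ :=
  (Polynomial.aeval ((Ideal.absNorm P.asIdeal : ℂ) ^ (-s))
    ((E.baseChange (P.adicCompletion K)).localPolynomial (P.adicCompletionIntegers K)))⁻¹

/-- The Hasse-Weil `L`-function of `E/ℚ(ρ)`, as an Euler product over all nonzero primes. -/
def ellipticL (E : WeierstrassCurve K) (s : ℂ) : ℂ := ∏' P, ellipticFactor E s P

/-- `f` is holomorphic on `U` and agrees there with `L` wherever `re s > 3 / 2`. -/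
def Continues (L : ℂ → ℂ) (U : Set ℂ) (f : ℂ → ℂ) : Prop :=
  DifferentiableOn ℂ f U ∧ ∀ s ∈ U, 3 / 2 < s.re → f s = L s

end EisensteinCurve

end

/-! The two sides are compared one Euler factor at a time. Completing the square turns the curve
into `y² + λy = x³`, with discriminant `-27λ⁴` and `c₄ = 0`.

At a prime `P` not dividing `3λ`, let `q` be the size of the residue field, `χ` its cubic residue
character and `J = J(χ, χ)`. Counting cube roots with `χ` gives `q + 1 + χ(λ)² J + χ(λ) J̄` points
(`card_point_cubicTwist`). The Jacobi sum generates `P` (`span_cubicJacobi`) and is `-1` modulo `3`,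
so `-J` is the primary generator of `P`. On it `χ₀` and `χ₀'` are trivial, hence the Hecke character
at `P` is `-χ_λ(J) J̄`. Cubic reciprocity, `χ_λ(J) = χ(λ)`, identifies this with `-χ(λ) J̄`.
Together with its conjugate it has sum `a_P` and product `q`, which is the local identity
(`localPolynomial_good`).

Reciprocity is derived from the Frobenius action on a cubic Gauss sum (`cubicChar_gauss`). This
needs different residue characteristics; the remaining case, a prime and its conjugate, is
`cubicChar_cubicJacobiConj`.

At `√-3` and `λ` the Hecke character vanishes. The discriminant has valuation `6`, respectively `4`,
which no change of variables brings to `0`, and `c₄ = 0` excludes multiplicative reduction, so both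
sides are `1`.

The Hecke products converge because the character has absolute value at most `N(I)^{1/2}`; the
elliptic product then converges as their product. Continuations agree by the identity theorem. -/

namespace EisensteinCurve

/-! ### Norms, units and residue representatives in `ℤ[ρ]`. -/

/-- The embedding of `ℤ[ρ]` into `ℂ` as a ring homomorphism. -/
noncomputable def toCHom : 𝓞 K →+* ℂ := (algebraMap K ℂ).comp (algebraMap (𝓞 K) K)

theorem toC_eq_toCHom (x : 𝓞 K) : toC x = toCHom x := rfl

theorem toCHom_injective : Function.Injective toCHom :=
  (injective_iff_map_eq_zero toCHom).2 fun x hx => by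
    have h : algebraMap K ℂ (algebraMap (𝓞 K) K x) = 0 := hx
    simpa using h

theorem toCHom_rhoInt : toCHom rhoInt = rho := rfl

theorem isPrimitiveRoot_rhoInt : IsPrimitiveRoot rhoInt 3 :=
  IsPrimitiveRoot.of_map_of_injective (f := toCHom)
    (by rw [toCHom_rhoInt]; exact isPrimitiveRoot_rho) toCHom_injective

theorem rhoInt_sq_add : rhoInt ^ 2 + rhoInt + 1 = 0 := by
  have h1 := isPrimitiveRoot_rhoInt.pow_eq_one
  have h2 : rhoInt - 1 ≠ 0 := sub_ne_zero.2 (isPrimitiveRoot_rhoInt.ne_one (by norm_num))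
  refine (mul_eq_zero.1 ?_).resolve_left h2
  linear_combination h1

/-- The norm form: `|x|² = N(x)`. -/
theorem norm_toCHom_sq (x : 𝓞 K) :
    ‖toCHom x‖ ^ 2 = (Ideal.absNorm (Ideal.span {x}) : ℝ) := by
  -- There is a single infinite place and it is complex, so the product formula for the norm reduces
  -- to one squared absolute value.
  have hcard : Fintype.card (InfinitePlace K) = 1 := by
    rw [InfinitePlace.card_eq_nrRealPlaces_add_nrComplexPlaces,
      IsCyclotomicExtension.Rat.nrRealPlaces_eq_zero (n := 3) K (by decide),
      IsCyclotomicExtension.Rat.nrComplexPlaces_eq_totient_div_two (n := 3)]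
    rfl
  have hcomplex : IsTotallyComplex K :=
    IsCyclotomicExtension.Rat.isTotallyComplex (n := 3) K (by decide)
  have hsub : Subsingleton (InfinitePlace K) := Fintype.card_le_one_iff_subsingleton.1 hcard.le
  have h := InfinitePlace.prod_eq_abs_norm (algebraMap (𝓞 K) K x)
  rw [Fintype.prod_subsingleton _ (InfinitePlace.mk (algebraMap K ℂ)), 
    IsTotallyComplex.mult_eq, InfinitePlace.apply] at h
  rw [Ideal.absNorm_span_singleton]
  change ‖algebraMap K ℂ (algebraMap (𝓞 K) K x)‖ ^ 2 = _
  rw [h, ← Algebra.coe_norm_int, Nat.cast_natAbs,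
    ← Int.cast_abs]
  norm_cast

theorem toCHom_mul_conj (x : 𝓞 K) :
    toCHom x * starRingEnd ℂ (toCHom x) = (Ideal.absNorm (Ideal.span {x}) : ℂ) := by
  rw [Complex.mul_conj, Complex.normSq_eq_norm_sq, norm_toCHom_sq,
    Complex.ofReal_natCast]

theorem norm_toCHom_of_pow_eq_one {w : 𝓞 K} {n : ℕ} (hn : n ≠ 0) (h : w ^ n = 1) :
    ‖toCHom w‖ = 1 := by
  have : toCHom w ^ n = 1 := by rw [← map_pow, h, map_one]
  exact Complex.norm_eq_one_of_pow_eq_one this hn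

theorem unit_mem (u : (𝓞 K)ˣ) : ∃ i : ℕ, (u : 𝓞 K) = rhoInt ^ i ∨ (u : 𝓞 K) = -rhoInt ^ i := by
  have hζ : IsPrimitiveRoot (⟨rho, IntermediateField.mem_adjoin_simple_self ℚ rho⟩ : K) 3 :=
    IsPrimitiveRoot.of_map_of_injective (f := algebraMap K ℂ) isPrimitiveRoot_rho
      (algebraMap K ℂ).injective
  have h := IsCyclotomicExtension.Rat.Three.Units.mem hζ u
  have h2 : ∀ h : IsUnit hζ.toInteger, ((h.unit : (𝓞 K)ˣ) : 𝓞 K) = rhoInt := fun h => rfl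
  simp only [List.mem_cons, List.not_mem_nil, or_false] at h
  rcases h with h | h | h | h | h | h
  · exact ⟨0, .inl (by simp [h])⟩
  · exact ⟨0, .inr (by simp [h])⟩
  · exact ⟨1, .inl (by rw [h, h2, pow_one])⟩
  · exact ⟨1, .inr (by rw [h, Units.val_neg, h2, pow_one])⟩
  · exact ⟨2, .inl (by rw [h, Units.val_pow_eq_pow_val, h2])⟩
  · exact ⟨2, .inr (by rw [h, Units.val_neg, Units.val_pow_eq_pow_val, h2])⟩

theorem unit_pow_six (u : (𝓞 K)ˣ) : (u : 𝓞 K) ^ 6 = 1 := by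
  have h := isPrimitiveRoot_rhoInt.pow_eq_one
  obtain ⟨i, hi | hi⟩ := unit_mem u
  · rw [hi, ← pow_mul, mul_comm, show 6 = 3 * 2 by norm_num, mul_assoc, pow_mul, h, one_pow]
  · rw [hi, Even.neg_pow (by decide), ← pow_mul, mul_comm, show 6 = 3 * 2 by norm_num, mul_assoc,
      pow_mul, h, one_pow]

theorem absNorm_dvd_of_dvd {a b : 𝓞 K} (h : a ∣ b) :
    Ideal.absNorm (Ideal.span {a}) ∣ Ideal.absNorm (Ideal.span {b}) :=
  Ideal.absNorm_dvd_absNorm_of_le ((Ideal.span_singleton_le_span_singleton).2 h)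

/-- Two elements on the unit circle differ by at most `2` in absolute value, so a nonzero difference
has norm at most `4`. This makes `residueRep` well defined for roots of unity modulo `3` (norm `9`)
and modulo `λ` (norm `l ≥ 7`). -/
theorem eq_of_dvd_sub {m w w' : 𝓞 K} (hm : 4 < Ideal.absNorm (Ideal.span {m}))
    (hw : ‖toCHom w‖ = 1) (hw' : ‖toCHom w'‖ = 1) (h : m ∣ w - w') : w = w' := by
  by_contra hne
  have hne' : w - w' ≠ 0 := sub_ne_zero.2 hne
  have h0 : 0 < Ideal.absNorm (Ideal.span {w - w'}) := by
    rw [Nat.pos_iff_ne_zero, Ne, Ideal.absNorm_eq_zero_iff, Ideal.span_singleton_eq_bot]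
    exact hne'
  have h1 := Nat.le_of_dvd h0 (absNorm_dvd_of_dvd h)
  have h2 : ‖toCHom (w - w')‖ ≤ 2 := by
    rw [map_sub]
    exact (norm_sub_le _ _).trans (by rw [hw, hw']; norm_num)
  have h3 : (Ideal.absNorm (Ideal.span {w - w'}) : ℝ) ≤ 4 := by
    rw [← norm_toCHom_sq]
    nlinarith [norm_nonneg (toCHom (w - w'))]
  have h4 : Ideal.absNorm (Ideal.span {w - w'}) ≤ 4 := by exact_mod_cast h3
  omega

theorem residueRep_eq {S : Set (𝓞 K)} {m a w : 𝓞 K}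
    (hS : ∀ x ∈ S, ∀ y ∈ S, m ∣ x - y → x = y) (hw : w ∈ S) (h : m ∣ a - w) :
    residueRep S m a = w := by
  have hex : ∃ w ∈ S, m ∣ a - w := ⟨w, hw, h⟩
  rw [residueRep, dif_pos hex]
  refine hS _ hex.choose_spec.1 _ hw ?_
  have := dvd_sub h hex.choose_spec.2
  simpa using this

theorem residueRep_eq_zero {S : Set (𝓞 K)} {m a : 𝓞 K} (h : ¬ ∃ w ∈ S, m ∣ a - w) :
    residueRep S m a = 0 := by
  rw [residueRep, dif_neg h]

theorem residueRep_mul {S : Set (𝓞 K)} {m a u v : 𝓞 K} (huv : v * u = 1)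
    (hS : ∀ x ∈ S, ∀ y ∈ S, m ∣ x - y → x = y)
    (hu : ∀ x ∈ S, u * x ∈ S) (hv : ∀ x ∈ S, v * x ∈ S) :
    residueRep S m (u * a) = u * residueRep S m a := by
  by_cases h : ∃ w ∈ S, m ∣ a - w
  · obtain ⟨w, hw, hwa⟩ := h
    rw [residueRep_eq hS hw hwa, residueRep_eq hS (hu w hw)]
    rw [← mul_sub]
    exact hwa.mul_left u
  · rw [residueRep_eq_zero h, residueRep_eq_zero, mul_zero]
    rintro ⟨w, hw, hwa⟩
    refine h ⟨v * w, hv w hw, ?_⟩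
    have := hwa.mul_left v
    rwa [mul_sub, ← mul_assoc, huv, one_mul] at this

theorem absNorm_span_natCast (n : ℕ) : Ideal.absNorm (Ideal.span {(n : 𝓞 K)}) = n ^ 2 := by
  have h := norm_toCHom_sq (n : 𝓞 K)
  rw [map_natCast, Complex.norm_natCast] at h
  exact_mod_cast h.symm

theorem absNorm_span_three : Ideal.absNorm (Ideal.span {(3 : 𝓞 K)}) = 9 := by
  have := absNorm_span_natCast 3
  simpa using this

theorem sqrtNegThree_sq : (1 + 2 * rhoInt) ^ 2 = -3 := by
  linear_combination 4 * rhoInt_sq_add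

theorem absNorm_sqrtNegThree : Ideal.absNorm (Ideal.span {1 + 2 * rhoInt}) = 3 := by
  have h : Ideal.span {(1 + 2 * rhoInt) ^ 2} = Ideal.span {(3 : 𝓞 K)} := by
    rw [sqrtNegThree_sq, Ideal.span_singleton_neg]
  have h2 := congrArg Ideal.absNorm h
  rw [← Ideal.span_singleton_pow, map_pow, absNorm_span_three] at h2
  exact Nat.pow_left_injective (n := 2) (by norm_num) (h2.trans (by norm_num))

theorem prime_sqrtNegThree : Prime (1 + 2 * rhoInt) := by
  have h0 : (1 + 2 * rhoInt) ≠ 0 := by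
    intro h
    have := absNorm_sqrtNegThree
    rw [h] at this
    simp at this
  rw [← Ideal.span_singleton_prime h0]
  apply Ideal.isPrime_of_irreducible_absNorm
  rw [absNorm_sqrtNegThree]
  exact Nat.prime_three

theorem sqrtNegThree_dvd_three : (1 + 2 * rhoInt) ∣ 3 :=
  ⟨-(1 + 2 * rhoInt), by linear_combination sqrtNegThree_sq⟩

theorem unit_eq_one_of_three_dvd {u : (𝓞 K)ˣ} (h : (3 : 𝓞 K) ∣ u - 1) : (u : 𝓞 K) = 1 := by
  refine eq_of_dvd_sub (m := 3) (by rw [absNorm_span_three]; norm_num)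
    (norm_toCHom_of_pow_eq_one (by norm_num) (unit_pow_six u)) (by simp) h

/-! ### Cubic residue characters of finite fields and their Jacobi sums. -/

section CubicCharacter

variable {F : Type*} [Field F] [Fintype F] (φ : 𝓞 K →+* F) (h3 : (3 : F) ≠ 0)

omit [Fintype F] in
include h3 in
theorem isPrimitiveRoot_map_rhoInt : IsPrimitiveRoot (φ rhoInt) 3 := by
  have hφ : φ rhoInt ^ 2 + φ rhoInt + 1 = 0 := by
    rw [← map_pow, ← map_add, ← map_one φ, ← map_add, rhoInt_sq_add, map_zero]
  have h1 : φ rhoInt ≠ 1 := by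
    intro h
    rw [h] at hφ
    exact h3 (by linear_combination hφ)
  have : Fact (Nat.Prime 3) := ⟨Nat.prime_three⟩
  have h2 := orderOf_eq_prime (p := 3) (x := φ rhoInt)
    (by rw [← map_pow, isPrimitiveRoot_rhoInt.pow_eq_one, map_one]) h1
  rw [← h2]
  exact IsPrimitiveRoot.orderOf _

include φ h3 in
theorem three_dvd_card_sub_one : 3 ∣ Fintype.card F - 1 := by
  have h := isPrimitiveRoot_map_rhoInt φ h3
  rw [h.eq_orderOf]
  exact orderOf_dvd_of_pow_eq_one (FiniteField.pow_card_sub_one_eq_one _ (h.ne_zero (by norm_num)))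

include φ h3 in
theorem three_mul_card_sub_one_div : 3 * ((Fintype.card F - 1) / 3) = Fintype.card F - 1 :=
  Nat.mul_div_cancel' (three_dvd_card_sub_one φ h3)

include h3 in
theorem exists_cubeRoot_map_eq {x : F} (hx : x ≠ 0) :
    ∃ w : 𝓞 K, w ^ 3 = 1 ∧ φ w = x ^ ((Fintype.card F - 1) / 3) := by
  have h : (x ^ ((Fintype.card F - 1) / 3)) ^ 3 = 1 := by
    rw [← pow_mul, mul_comm, three_mul_card_sub_one_div φ h3,
      FiniteField.pow_card_sub_one_eq_one _ hx]
  obtain ⟨i, -, hi⟩ := (isPrimitiveRoot_map_rhoInt φ h3).eq_pow_of_pow_eq_one h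
  refine ⟨rhoInt ^ i, ?_, by rw [map_pow, hi]⟩
  rw [← pow_mul, mul_comm, pow_mul, isPrimitiveRoot_rhoInt.pow_eq_one, one_pow]

omit [Fintype F] in
include h3 in
theorem cubeRoot_map_injective {w w' : 𝓞 K} (hw : w ^ 3 = 1) (hw' : w' ^ 3 = 1)
    (h : φ w = φ w') : w = w' := by
  obtain ⟨i, hi, rfl⟩ := isPrimitiveRoot_rhoInt.eq_pow_of_pow_eq_one hw
  obtain ⟨j, hj, rfl⟩ := isPrimitiveRoot_rhoInt.eq_pow_of_pow_eq_one hw'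
  rw [map_pow, map_pow] at h
  rw [(isPrimitiveRoot_map_rhoInt φ h3).pow_inj hi hj h]

open Classical in
/-- The cubic residue character of a finite field `F` which is an algebra over `ℤ[ρ]` via `φ`: it
maps `x ≠ 0` to the cube root of unity whose image in `F` is `x ^ ((#F - 1) / 3)`. -/
noncomputable def cubicChar : MulChar F (𝓞 K) where
  toFun x := if hx : x = 0 then 0 else (exists_cubeRoot_map_eq φ h3 hx).choose
  map_one' := by
    rw [dif_neg one_ne_zero]
    have h := (exists_cubeRoot_map_eq φ h3 (one_ne_zero (α := F))).choose_spec
    exact cubeRoot_map_injective φ h3 h.1 (one_pow 3) (by rw [h.2, one_pow, map_one])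
  map_mul' x y := by
    by_cases hx : x = 0
    · simp [hx]
    by_cases hy : y = 0
    · simp [hy]
    rw [dif_neg hx, dif_neg hy, dif_neg (mul_ne_zero hx hy)]
    have h1 := (exists_cubeRoot_map_eq φ h3 hx).choose_spec
    have h2 := (exists_cubeRoot_map_eq φ h3 hy).choose_spec
    have h := (exists_cubeRoot_map_eq φ h3 (mul_ne_zero hx hy)).choose_spec
    exact cubeRoot_map_injective φ h3 h.1 (by rw [mul_pow, h1.1, h2.1, one_mul])
      (by rw [h.2, map_mul, h1.2, h2.2, mul_pow])
  map_nonunit' x hx := dif_pos (by simpa using hx)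

theorem cubicChar_apply_of_ne_zero {x : F} (hx : x ≠ 0) :
    cubicChar φ h3 x = (exists_cubeRoot_map_eq φ h3 hx).choose := dif_neg hx

theorem cubicChar_pow_three {x : F} (hx : x ≠ 0) : cubicChar φ h3 x ^ 3 = 1 := by
  rw [cubicChar_apply_of_ne_zero φ h3 hx]
  exact (exists_cubeRoot_map_eq φ h3 hx).choose_spec.1

theorem map_cubicChar_of_ne_zero {x : F} (hx : x ≠ 0) :
    φ (cubicChar φ h3 x) = x ^ ((Fintype.card F - 1) / 3) := by
  rw [cubicChar_apply_of_ne_zero φ h3 hx]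
  exact (exists_cubeRoot_map_eq φ h3 hx).choose_spec.2

include φ h3 in
theorem card_sub_one_div_pos : 0 < (Fintype.card F - 1) / 3 := by
  have h1 := three_mul_card_sub_one_div φ h3
  have h2 := Fintype.one_lt_card (α := F)
  omega

theorem map_cubicChar (x : F) : φ (cubicChar φ h3 x) = x ^ ((Fintype.card F - 1) / 3) := by
  by_cases hx : x = 0
  · rw [hx, MulChar.map_zero, map_zero, zero_pow (card_sub_one_div_pos φ h3).ne']
  · exact map_cubicChar_of_ne_zero φ h3 hx

theorem cubicChar_eq_of_map_eq {x : F} {w : 𝓞 K} (hx : x ≠ 0) (hw : w ^ 3 = 1)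
    (h : φ w = x ^ ((Fintype.card F - 1) / 3)) : cubicChar φ h3 x = w :=
  cubeRoot_map_injective φ h3 (cubicChar_pow_three φ h3 hx) hw (by rw [map_cubicChar, h])

theorem cubicChar_pow_eq_one : cubicChar φ h3 ^ 3 = 1 := by
  ext x
  rw [MulChar.pow_apply_coe, cubicChar_pow_three φ h3 x.ne_zero, MulChar.one_apply_coe]

theorem cubicChar_neg_one : cubicChar φ h3 (-1) = 1 := by
  have h1 := cubicChar_pow_three φ h3 (neg_ne_zero.2 (one_ne_zero (α := F)))
  rw [pow_succ, ← map_pow, neg_one_sq, map_one, one_mul] at h1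
  exact h1

theorem cubicChar_neg (x : F) : cubicChar φ h3 (-x) = cubicChar φ h3 x := by
  rw [← neg_one_mul, map_mul, cubicChar_neg_one, one_mul]

theorem cubicChar_ne_one : cubicChar φ h3 ≠ 1 := by
  intro h
  obtain ⟨g, hg⟩ := IsCyclic.exists_generator (α := Fˣ)
  have hφ := map_cubicChar φ h3 (g : F)
  rw [h, MulChar.one_apply_coe, map_one] at hφ
  have h1 : g ^ ((Fintype.card F - 1) / 3) = 1 := by
    ext
    rw [Units.val_pow_eq_pow_val, ← hφ, Units.val_one]
  classical
  have h2 := orderOf_eq_card_of_forall_mem_zpowers hg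
  rw [Nat.card_eq_fintype_card, Fintype.card_units] at h2
  have h3' := Nat.le_of_dvd (card_sub_one_div_pos φ h3) (orderOf_dvd_of_pow_eq_one h1)
  have h4 := three_mul_card_sub_one_div φ h3
  have h5 := card_sub_one_div_pos φ h3
  omega

theorem cubicChar_sq_ne_one : cubicChar φ h3 * cubicChar φ h3 ≠ 1 := by
  intro h
  have h2 := cubicChar_pow_eq_one φ h3
  rw [pow_succ, pow_two, h, one_mul] at h2
  exact cubicChar_ne_one φ h3 h2

/-- The cubic Jacobi sum of a finite field over `ℤ[ρ]`. -/
noncomputable def cubicJacobi : 𝓞 K := jacobiSum (cubicChar φ h3) (cubicChar φ h3)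

theorem three_dvd_cubicJacobi_add_one : (3 : 𝓞 K) ∣ cubicJacobi φ h3 + 1 := by
  obtain ⟨z, -, hz⟩ := exists_jacobiSum_eq_neg_one_add (n := 3) (by norm_num)
    (cubicChar_pow_eq_one φ h3) (cubicChar_pow_eq_one φ h3) (three_dvd_card_sub_one φ h3)
    isPrimitiveRoot_rhoInt
  -- The witness comes from `(ρ - 1)² = -3ρ`.
  refine ⟨-rhoInt * z, ?_⟩
  rw [cubicJacobi, hz]
  linear_combination z * rhoInt_sq_add

/-- In `F` the Jacobi sum becomes `∑ xᵐ (1 - x)ᵐ` with `m = (#F - 1) / 3`. The summand is a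
polynomial of degree `2m < #F - 1`, and power sums of such exponents vanish. -/
theorem map_cubicJacobi : φ (cubicJacobi φ h3) = 0 := by
  have h4 := three_mul_card_sub_one_div φ h3
  have h5 := card_sub_one_div_pos φ h3
  set m := (Fintype.card F - 1) / 3 with hm
  rw [cubicJacobi, jacobiSum, map_sum]
  simp_rw [map_mul, map_cubicChar, ← hm, sub_eq_add_neg, add_pow, one_pow, one_mul,
    Finset.mul_sum]
  rw [Finset.sum_comm]
  refine Finset.sum_eq_zero fun i hi => ?_
  have hi' : i ≤ m := Nat.lt_succ_iff.1 (Finset.mem_range.1 hi)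
  have h6 := FiniteField.sum_pow_lt_card_sub_one F (m + (m - i)) (by omega)
  calc ∑ x : F, x ^ m * ((-x) ^ (m - i) * (m.choose i : F))
      = ∑ x : F, ((-1) ^ (m - i) * (m.choose i : F)) * x ^ (m + (m - i)) :=
        Finset.sum_congr rfl fun x _ => by
          rw [pow_add, neg_pow x]; ring
    _ = 0 := by rw [← Finset.mul_sum, h6, mul_zero]

theorem conj_toCHom_cubicChar (x : F) :
    starRingEnd ℂ (toCHom (cubicChar φ h3 x)) = toCHom (cubicChar φ h3 x ^ 2) := by
  by_cases hx : x = 0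
  · rw [hx, MulChar.map_zero, zero_pow two_ne_zero, map_zero, map_zero]
  have h := cubicChar_pow_three φ h3 hx
  have h1 := norm_toCHom_of_pow_eq_one (by norm_num) h
  rw [← Complex.inv_eq_conj h1, map_pow]
  refine inv_eq_of_mul_eq_one_right ?_
  rw [← pow_succ', ← map_pow, h, map_one]

theorem inv_cubicChar_apply (x : F) : (cubicChar φ h3)⁻¹ x = cubicChar φ h3 x ^ 2 := by
  have h : (cubicChar φ h3)⁻¹ = cubicChar φ h3 ^ 2 :=
    inv_eq_of_mul_eq_one_right (by rw [← pow_succ', cubicChar_pow_eq_one])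
  rw [h, MulChar.pow_apply' _ two_ne_zero]

theorem conj_toCHom_cubicJacobi : starRingEnd ℂ (toCHom (cubicJacobi φ h3)) =
    toCHom (jacobiSum (cubicChar φ h3)⁻¹ (cubicChar φ h3)⁻¹) := by
  rw [cubicJacobi, jacobiSum, jacobiSum, map_sum, map_sum, map_sum]
  refine Finset.sum_congr rfl fun x _ => ?_
  rw [map_mul, map_mul, conj_toCHom_cubicChar, conj_toCHom_cubicChar, inv_cubicChar_apply,
    inv_cubicChar_apply, map_mul]

theorem cubicJacobi_mul_jacobiSum_inv :
    cubicJacobi φ h3 * jacobiSum (cubicChar φ h3)⁻¹ (cubicChar φ h3)⁻¹ = Fintype.card F := by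
  apply toCHom_injective
  have hchar : ringChar ℂ ≠ ringChar F := by
    rw [ringChar.eq_zero]
    exact (CharP.char_ne_zero_of_finite F (ringChar F)).symm
  have hne : (cubicChar φ h3).ringHomComp toCHom ≠ 1 :=
    (MulChar.ringHomComp_ne_one_iff toCHom_injective).2 (cubicChar_ne_one φ h3)
  have hne2 : (cubicChar φ h3).ringHomComp toCHom * (cubicChar φ h3).ringHomComp toCHom ≠ 1 := by
    rw [← MulChar.ringHomComp_mul]
    exact (MulChar.ringHomComp_ne_one_iff toCHom_injective).2 (cubicChar_sq_ne_one φ h3)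
  have h := jacobiSum_mul_jacobiSum_inv hchar hne hne hne2
  rw [MulChar.ringHomComp_inv, jacobiSum_ringHomComp, jacobiSum_ringHomComp] at h
  rw [map_mul, map_natCast, ← h, cubicJacobi]

theorem absNorm_cubicJacobi :
    Ideal.absNorm (Ideal.span {cubicJacobi φ h3}) = Fintype.card F := by
  have h := toCHom_mul_conj (cubicJacobi φ h3)
  rw [conj_toCHom_cubicJacobi, ← map_mul, cubicJacobi_mul_jacobiSum_inv, map_natCast] at h
  exact_mod_cast h.symm

/-- The Jacobi sum lies in the kernel, and both ideals have norm `#F`. -/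
theorem span_cubicJacobi (hφ : Function.Surjective φ) :
    Ideal.span {cubicJacobi φ h3} = RingHom.ker φ := by
  have hle : Ideal.span {cubicJacobi φ h3} ≤ RingHom.ker φ := by
    rw [Ideal.span_singleton_le_iff_mem, RingHom.mem_ker, map_cubicJacobi]
  have hcard : Ideal.absNorm (RingHom.ker φ) = Fintype.card F := by
    rw [Ideal.absNorm_apply, Submodule.cardQuot_apply, ← Nat.card_eq_fintype_card]
    exact Nat.card_congr (RingHom.quotientKerEquivOfSurjective hφ).toEquiv
  obtain ⟨I, hI⟩ := Ideal.dvd_iff_le.2 hle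
  have h := congrArg Ideal.absNorm hI
  rw [map_mul, hcard, absNorm_cubicJacobi] at h
  have h1 : Ideal.absNorm I = 1 := by
    have := Fintype.card_pos (α := F)
    nlinarith
  rw [hI, Ideal.absNorm_eq_one_iff.1 h1, Ideal.mul_top]

end CubicCharacter

/-! ### Gauss sums and cubic reciprocity for different residue characteristics. -/

theorem gaussSum_pow_char_pow {R : Type*} [CommRing R] [Fintype R] {R' : Type*} [CommRing R']
    (p n : ℕ) [Fact p.Prime] [CharP R' p] (χ : MulChar R R') (ψ : AddChar R R') :
    gaussSum χ ψ ^ p ^ n = gaussSum (χ ^ p ^ n) (ψ ^ p ^ n) := by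
  induction n with
  | zero => simp
  | succ n ih => rw [pow_succ, pow_mul, ih, gaussSum_frob, ← pow_mul, ← pow_mul]

section Reciprocity

variable {F F' : Type*} [Field F] [Fintype F] [Field F'] [Fintype F']
  (φ : 𝓞 K →+* F) (h3 : (3 : F) ≠ 0) (φ' : 𝓞 K →+* F') (h3' : (3 : F') ≠ 0)

theorem card_cast_ne_zero (hchar : ringChar F' ≠ ringChar F) : (Fintype.card F : F') ≠ 0 := by
  obtain ⟨n, hp, hc⟩ := FiniteField.card F (ringChar F)
  obtain ⟨n', hp', -⟩ := FiniteField.card F' (ringChar F')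
  rw [hc, Nat.cast_pow]
  refine pow_ne_zero _ fun h => hchar ?_
  exact (Nat.prime_dvd_prime_iff_eq hp' hp).1 ((ringChar.spec F' _).1 h)

omit [Fintype F'] in
include h3' in
theorem orderOf_ringHomComp_cubicChar {T : Type*} [Field T] (θ : F' →+* T) :
    orderOf ((cubicChar φ h3).ringHomComp (θ.comp φ')) = 3 := by
  have : Fact (Nat.Prime 3) := ⟨Nat.prime_three⟩
  refine orderOf_eq_prime ?_ fun h => cubicChar_ne_one φ h3 ?_
  · rw [MulChar.ringHomComp_pow, cubicChar_pow_eq_one]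
    ext x
    simp
  · refine MulChar.ext fun x => ?_
    have hx := MulChar.ext_iff.1 h x
    rw [MulChar.ringHomComp_apply, MulChar.one_apply_coe, RingHom.comp_apply,
      map_eq_one_iff θ θ.injective] at hx
    rw [MulChar.one_apply_coe]
    exact cubeRoot_map_injective φ' h3' (cubicChar_pow_three φ h3 x.ne_zero) (one_pow 3)
      (by rw [hx, map_one])

/-- The reciprocity law read off from the Frobenius action on a cubic Gauss sum. -/
theorem cubicChar_gauss (hchar : ringChar F' ≠ ringChar F) :
    cubicChar φ' h3' (Fintype.card F : F') * cubicChar φ' h3' (φ' (cubicJacobi φ h3)) *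
      cubicChar φ h3 (Fintype.card F' : F) = 1 := by
  obtain ⟨n, hp, hc⟩ := FiniteField.card F' (ringChar F')
  have hN : (Fintype.card F' : F) ≠ 0 := card_cast_ne_zero hchar.symm
  -- The Gauss sum of `F` is formed in an extension `T` of `F'`, where raising to the power `#F'` is
  -- additive; the values of the cubic character reach `T` through `φ'`.
  let ψ := AddChar.FiniteField.primitiveChar F F' hchar
  let T := CyclotomicField ψ.n F'
  let θ : F' →+* T := algebraMap F' T
  have hcharT : ringChar F' = ringChar T := Algebra.ringChar_eq F' T
  have : Fact (ringChar F').Prime := ⟨hp⟩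
  have : CharP T (ringChar F') := hcharT ▸ ringChar.charP T
  set χ := (cubicChar φ h3).ringHomComp (θ.comp φ') with hχ
  have hord : orderOf χ = 3 := orderOf_ringHomComp_cubicChar φ h3 φ' h3' θ
  have hcube : χ ^ 3 = 1 := hord ▸ pow_orderOf_eq_one χ
  have hg3 : gaussSum χ ψ.char ^ 3 = θ ((Fintype.card F : F') * φ' (cubicJacobi φ h3)) := by
    have h := gaussSum_pow_eq_prod_jacobiSum (χ := χ) (ψ := ψ.char) (by omega) ψ.prim
    rw [hord, show Finset.Ico 1 (3 - 1) = {1} by decide, Finset.prod_singleton, pow_one,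
      jacobiSum_ringHomComp, hχ, MulChar.ringHomComp_apply, cubicChar_neg_one, map_one,
      one_mul] at h
    rw [h, map_mul, map_natCast]
    rfl
  have hm := three_mul_card_sub_one_div φ' h3'
  have hmpos := card_sub_one_div_pos φ' h3'
  set m := (Fintype.card F' - 1) / 3 with hmdef
  have hcard : Fintype.card F' = 3 * m + 1 := by omega
  -- Frobenius acts on the character values and on `ψ`. Since `#F' ≡ 1` modulo `3`, the cubic
  -- character is unchanged and only `ψ` is shifted by `#F'`.
  have hgN : gaussSum χ ψ.char ^ (3 * m + 1) =
      gaussSum χ (ψ.char.mulShift (Fintype.card F' : F)) := by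
    rw [← hcard, hc, gaussSum_pow_char_pow, ← hc, AddChar.pow_mulShift]
    congr 1
    rw [hcard, pow_succ, pow_mul, hcube, one_pow, one_mul]
  have hshift := gaussSum_mulShift χ ψ.char (Units.mk0 _ hN)
  rw [Units.val_mk0, ← hgN] at hshift
  have hg0 : gaussSum χ ψ.char ≠ 0 := by
    refine gaussSum_ne_zero_of_nontrivial ?_ ?_ ψ.prim
    · rw [← map_natCast θ]
      exact (map_ne_zero θ).2 (card_cast_ne_zero hchar)
    · intro h
      rw [h, orderOf_one] at hord
      omega
  -- Comparing the Frobenius power of the Gauss sum with `(g³)ᵐ g`, where `g³` is known from `hg3`,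
  -- and cancelling `g`.
  have hprod : θ (φ' (cubicChar φ h3 (Fintype.card F' : F)) *
      ((Fintype.card F : F') * φ' (cubicJacobi φ h3)) ^ m) = 1 := by
    refine mul_right_cancel₀ hg0 ?_
    rw [one_mul, map_mul, map_pow, ← hg3, mul_assoc, ← pow_mul, ← pow_succ]
    exact hshift
  rw [map_eq_one_iff θ θ.injective] at hprod
  have hne : (Fintype.card F : F') * φ' (cubicJacobi φ h3) ≠ 0 := by
    intro h
    rw [h, zero_pow hmpos.ne', mul_zero] at hprod
    exact zero_ne_one hprod
  rw [← map_mul]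
  refine cubeRoot_map_injective φ' h3' ?_ (one_pow 3) ?_
  · rw [mul_pow, cubicChar_pow_three _ _ hne, cubicChar_pow_three _ _ hN, one_mul]
  · rw [map_mul, map_cubicChar, map_one, ← hmdef, mul_comm]
    exact hprod

/-- **Cubic reciprocity**, for residue fields of different characteristics. -/
theorem cubicChar_reciprocity (hchar : ringChar F' ≠ ringChar F) :
    cubicChar φ' h3' (φ' (cubicJacobi φ h3)) = cubicChar φ h3 (φ (cubicJacobi φ' h3')) := by
  have h1 := cubicChar_gauss φ h3 φ' h3' hchar
  have h2 := cubicChar_gauss φ' h3' φ h3 hchar.symm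
  -- Exchanging the two fields in `cubicChar_gauss` leaves this product of character values of the
  -- cardinalities unchanged, so it can be cancelled.
  have h4 : cubicChar φ' h3' (Fintype.card F : F') * cubicChar φ h3 (Fintype.card F' : F) ≠ 0 := by
    intro h
    rw [mul_right_comm, h, zero_mul] at h1
    exact zero_ne_one h1
  refine mul_left_cancel₀ h4 ?_
  linear_combination h1 - h2

end Reciprocity

/-- Residue fields are handled as abstract finite fields with a map from `ℤ[ρ]`, so that quotients
and residue fields of completions are covered by the same lemmas. -/
theorem exists_finite_field_quotient {P : Ideal (𝓞 K)} (hP : P.IsPrime) (h0 : P ≠ ⊥) :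
    ∃ (F : Type) (_ : Field F) (_ : Fintype F) (φ : 𝓞 K →+* F),
      Function.Surjective φ ∧ RingHom.ker φ = P := by
  have hmax : P.IsMaximal := hP.isMaximal h0
  let : Field (𝓞 K ⧸ P) := Ideal.Quotient.field P
  have : Finite (𝓞 K ⧸ P) := Ideal.finiteQuotientOfFreeOfNeBot P h0
  exact ⟨𝓞 K ⧸ P, inferInstance, Fintype.ofFinite _, Ideal.Quotient.mk P,
    Ideal.Quotient.mk_surjective, Ideal.mk_ker⟩

theorem absNorm_span_eq_of_conj {x y : 𝓞 K} (h : starRingEnd ℂ (toCHom x) = toCHom y) :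
    Ideal.absNorm (Ideal.span {x}) = Ideal.absNorm (Ideal.span {y}) := by
  have hx := toCHom_mul_conj x
  have hy := toCHom_mul_conj y
  rw [← h, Complex.conj_conj, mul_comm, hx] at hy
  exact_mod_cast hy

theorem span_eq_of_dvd_of_absNorm_eq {a b : 𝓞 K} (hb : b ≠ 0) (h : a ∣ b)
    (hn : Ideal.absNorm (Ideal.span {a}) = Ideal.absNorm (Ideal.span {b})) :
    Ideal.span {a} = Ideal.span {b} := by
  obtain ⟨c, rfl⟩ := h
  rw [← Ideal.span_singleton_mul_span_singleton, map_mul] at hn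
  have h0 : Ideal.absNorm (Ideal.span {a}) ≠ 0 := by
    rw [Ne, Ideal.absNorm_eq_zero_iff, Ideal.span_singleton_eq_bot]
    exact left_ne_zero_of_mul hb
  have hc : Ideal.absNorm (Ideal.span {c}) = 1 :=
    (Nat.mul_left_cancel (Nat.pos_of_ne_zero h0) ((mul_one _).trans hn)).symm
  rw [← Ideal.span_singleton_mul_span_singleton, Ideal.absNorm_eq_one_iff.1 hc, Ideal.mul_top]

/-- A generator of an ideal is determined by its residue class modulo `3`, if that is `±1`. -/
theorem eq_neg_of_span_eq {x y : 𝓞 K} (hx : (3 : 𝓞 K) ∣ x - 1) (hy : (3 : 𝓞 K) ∣ y + 1)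
    (h : Ideal.span {x} = Ideal.span {y}) : x = -y := by
  obtain ⟨u, hu⟩ := Ideal.span_singleton_eq_span_singleton.1 h
  have h1 : (3 : 𝓞 K) ∣ ((-u : (𝓞 K)ˣ) : 𝓞 K) - 1 := by
    rw [Units.val_neg]
    have := dvd_sub (hx.mul_right (u : 𝓞 K)) hy
    rw [hu.symm] at this
    exact this.trans (dvd_of_eq (by ring))
  have h2 := unit_eq_one_of_three_dvd h1
  rw [Units.val_neg] at h2
  rw [← hu]
  linear_combination -x * h2

/-! ### Cubic reciprocity between a prime and its complex conjugate. -/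

section SameCharacteristic

variable {F : Type*} [Field F] [Fintype F] (φ : 𝓞 K →+* F) (h3 : (3 : F) ≠ 0)

/-- The complex conjugate of the cubic Jacobi sum. -/
noncomputable def cubicJacobiConj : 𝓞 K := jacobiSum (cubicChar φ h3)⁻¹ (cubicChar φ h3)⁻¹

theorem three_dvd_cubicJacobiConj_add_one : (3 : 𝓞 K) ∣ cubicJacobiConj φ h3 + 1 := by
  have h : (cubicChar φ h3)⁻¹ ^ 3 = 1 := by rw [inv_pow, cubicChar_pow_eq_one, inv_one]
  obtain ⟨z, -, hz⟩ := exists_jacobiSum_eq_neg_one_add (n := 3) (by norm_num)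
    h h (three_dvd_card_sub_one φ h3) isPrimitiveRoot_rhoInt
  refine ⟨-rhoInt * z, ?_⟩
  rw [cubicJacobiConj, hz]
  linear_combination z * rhoInt_sq_add

theorem cubicJacobi_mul_conj : cubicJacobi φ h3 * cubicJacobiConj φ h3 = Fintype.card F :=
  cubicJacobi_mul_jacobiSum_inv φ h3

theorem conj_toCHom_cubicJacobi' :
    starRingEnd ℂ (toCHom (cubicJacobi φ h3)) = toCHom (cubicJacobiConj φ h3) :=
  conj_toCHom_cubicJacobi φ h3

theorem absNorm_cubicJacobiConj :
    Ideal.absNorm (Ideal.span {cubicJacobiConj φ h3}) = Fintype.card F := by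
  rw [← absNorm_span_eq_of_conj (conj_toCHom_cubicJacobi' φ h3), absNorm_cubicJacobi]

theorem cubicJacobiConj_ne_zero : cubicJacobiConj φ h3 ≠ 0 := by
  intro h
  have h1 := absNorm_cubicJacobiConj φ h3
  rw [h] at h1
  exact Fintype.card_ne_zero (α := F) (by simpa using h1.symm)

-- Modulo `a` one has `J̄ = -J`, hence `#F = J J̄ = -J²`. The two factors of `cubicChar_gauss` at
-- `a` then combine to the cube of a character value and drop out.
variable {φ} in
theorem cubicChar_absNorm_of_prime (hφ : Function.Surjective φ)
    (hne : Ideal.span {cubicJacobi φ h3} ≠ Ideal.span {cubicJacobiConj φ h3})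
    {a : 𝓞 K} (ha : Prime a) (hat : a ∣ cubicJacobi φ h3 + cubicJacobiConj φ h3) :
    cubicChar φ h3 (Ideal.absNorm (Ideal.span {a}) : F) = 1 := by
  have hprime : (Ideal.span {a}).IsPrime := (Ideal.span_singleton_prime ha.ne_zero).2 ha
  have hbot : Ideal.span {a} ≠ ⊥ := by simpa using ha.ne_zero
  obtain ⟨F', _, _, φ', hφ', hker⟩ := exists_finite_field_quotient hprime hbot
  have hmem : ∀ x, φ' x = 0 ↔ a ∣ x := fun x => by
    rw [← RingHom.mem_ker, hker, Ideal.mem_span_singleton]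
  set J := cubicJacobi φ h3
  set J' := cubicJacobiConj φ h3
  -- Both Jacobi sums are `-1` modulo `3`, so a common divisor of `3` and their sum divides `2`,
  -- hence `1`.
  have h3' : (3 : F') ≠ 0 := by
    intro h
    have h' : a ∣ 3 := (hmem 3).1 (by rw [map_ofNat, h])
    have h1 := (h'.trans (three_dvd_cubicJacobi_add_one φ h3)).add
      (h'.trans (three_dvd_cubicJacobiConj_add_one φ h3))
    have h2 := dvd_sub h' (dvd_sub h1 hat)
    exact ha.not_dvd_one (h2.trans (dvd_of_eq (by ring)))
  have hcardF' : Fintype.card F' = Ideal.absNorm (Ideal.span {a}) := by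
    rw [← absNorm_cubicJacobi φ' h3', span_cubicJacobi φ' h3' hφ', hker]
  -- In equal characteristic `J` and `J̄` would have product and sum zero modulo `a`, so `a` would
  -- divide both, and they would generate the same ideal.
  have hchar : ringChar F' ≠ ringChar F := by
    intro h
    have hq : φ' J * φ' J' = 0 := by
      obtain ⟨n, -, hc⟩ := FiniteField.card F (ringChar F)
      rw [← map_mul, cubicJacobi_mul_conj, map_natCast, hc, Nat.cast_pow, ← h,
        ringChar.Nat.cast_ringChar, zero_pow n.ne_zero]
    have hsum : φ' J + φ' J' = 0 := by rw [← map_add, hmem]; exact hat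
    have hJ : φ' J = 0 := by
      rcases mul_eq_zero.1 hq with h | h
      · exact h
      · rwa [h, add_zero] at hsum
    have hJ' : φ' J' = 0 := by rwa [hJ, zero_add] at hsum
    rw [hmem] at hJ hJ'
    have hmax : (Ideal.span {J}).IsMaximal := by
      rw [span_cubicJacobi φ h3 hφ]
      exact RingHom.ker_isMaximal_of_surjective φ hφ
    have hspan : Ideal.span {J} = Ideal.span {a} :=
      hmax.eq_of_le hprime.ne_top (Ideal.span_singleton_le_span_singleton.2 hJ)
    refine hne (hspan.trans ?_)
    refine span_eq_of_dvd_of_absNorm_eq (cubicJacobiConj_ne_zero φ h3) hJ' ?_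
    rw [absNorm_cubicJacobiConj, ← hspan, absNorm_cubicJacobi]
  have hgauss := cubicChar_gauss φ h3 φ' h3' hchar
  have hsum : φ' J' = -φ' J := by
    rw [eq_neg_iff_add_eq_zero, add_comm, ← map_add, hmem]; exact hat
  have hJ0 : φ' J ≠ 0 := by
    intro h
    rw [h, MulChar.map_zero, mul_zero, zero_mul] at hgauss
    exact zero_ne_one hgauss
  have hq : (Fintype.card F : F') = -(φ' J * φ' J) := by
    rw [← map_natCast φ', ← cubicJacobi_mul_conj φ h3, map_mul]
    change φ' J * φ' J' = _
    rw [hsum, mul_neg]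
  rw [hq, cubicChar_neg, map_mul] at hgauss
  have hcube := cubicChar_pow_three φ' h3' hJ0
  rw [pow_succ, pow_two] at hcube
  change _ * cubicChar φ' h3' (φ' J) * _ = 1 at hgauss
  rw [hcube, one_mul, hcardF'] at hgauss
  exact hgauss

variable {φ} in
theorem cubicChar_absNorm_of_dvd (hφ : Function.Surjective φ)
    (hne : Ideal.span {cubicJacobi φ h3} ≠ Ideal.span {cubicJacobiConj φ h3}) (a : 𝓞 K)
    (hat : a ∣ cubicJacobi φ h3 + cubicJacobiConj φ h3) :
    cubicChar φ h3 (Ideal.absNorm (Ideal.span {a}) : F) = 1 := by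
  induction a using UniqueFactorizationMonoid.induction_on_prime with
  | h₁ =>
    -- The case `a = 0`: the sum is `1` modulo `3`, so it is not zero.
    have h1 := dvd_sub (dvd_add (three_dvd_cubicJacobi_add_one φ h3)
      (three_dvd_cubicJacobiConj_add_one φ h3)) (dvd_refl (3 : 𝓞 K))
    have h2 : (3 : 𝓞 K) ∣ -1 := by
      refine h1.trans (dvd_of_eq ?_)
      linear_combination zero_dvd_iff.1 hat
    have h4 := absNorm_dvd_of_dvd h2
    rw [absNorm_span_three, Ideal.span_singleton_neg, Ideal.span_singleton_one,
      Ideal.absNorm_top] at h4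
    norm_num at h4
  | h₂ u hu =>
    rw [Ideal.span_singleton_eq_top.2 hu, Ideal.absNorm_top, Nat.cast_one, map_one]
  | h₃ a p ha hp ih =>
    rw [← Ideal.span_singleton_mul_span_singleton, map_mul, Nat.cast_mul, map_mul,
      ih ((dvd_mul_left a p).trans hat),
      cubicChar_absNorm_of_prime h3 hφ hne hp ((dvd_mul_right p a).trans hat), one_mul]

variable {φ} in
/-- Cubic reciprocity between a primary prime and its complex conjugate. -/
theorem cubicChar_cubicJacobiConj (hφ : Function.Surjective φ)
    (hne : Ideal.span {cubicJacobi φ h3} ≠ Ideal.span {cubicJacobiConj φ h3}) :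
    cubicChar φ h3 (φ (cubicJacobiConj φ h3)) = 1 := by
  have h := cubicChar_absNorm_of_dvd h3 hφ hne _ dvd_rfl
  set t := cubicJacobi φ h3 + cubicJacobiConj φ h3 with ht
  have hreal : starRingEnd ℂ (toCHom t) = toCHom t := by
    rw [ht, map_add, map_add, ← conj_toCHom_cubicJacobi', Complex.conj_conj, add_comm]
  -- The sum `t` is real, so its norm is `t²`. As `t` reduces to `J̄` modulo `J`, the previous lemma
  -- says that the square of the desired value is `1`; its cube is `1` as well.
  have hsq : (Ideal.absNorm (Ideal.span {t}) : 𝓞 K) = t * t := by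
    apply toCHom_injective
    rw [map_natCast, ← toCHom_mul_conj, hreal, map_mul]
  rw [← map_natCast φ, hsq, map_mul, map_mul, ht, map_add, map_cubicJacobi, zero_add] at h
  have h0 : φ (cubicJacobiConj φ h3) ≠ 0 := by
    intro h0
    rw [h0, MulChar.map_zero, mul_zero] at h
    exact zero_ne_one h
  have hcube := cubicChar_pow_three φ h3 h0
  rwa [pow_succ, pow_two, h, one_mul] at hcube

end SameCharacteristic

/-- **Cubic reciprocity** between a prime of prime norm and any other prime not dividing `3`. -/
theorem cubicChar_reciprocity_of_prime_card {F F' : Type*} [Field F] [Fintype F] [Field F']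
    [Fintype F'] {φ : 𝓞 K →+* F} (h3 : (3 : F) ≠ 0) {φ' : 𝓞 K →+* F'} (h3' : (3 : F') ≠ 0)
    (hφ : Function.Surjective φ) (hφ' : Function.Surjective φ')
    (hcard : (Fintype.card F).Prime) (hker : RingHom.ker φ ≠ RingHom.ker φ') :
    cubicChar φ' h3' (φ' (cubicJacobi φ h3)) = cubicChar φ h3 (φ (cubicJacobi φ' h3')) := by
  by_cases hchar : ringChar F' = ringChar F
  swap
  · exact cubicChar_reciprocity φ h3 φ' h3' hchar
  have hJ := span_cubicJacobi φ h3 hφ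
  have hJ' := span_cubicJacobi φ' h3' hφ'
  have hq : φ' (cubicJacobi φ h3) * φ' (cubicJacobiConj φ h3) = 0 := by
    obtain ⟨n, -, hc⟩ := FiniteField.card F (ringChar F)
    rw [← map_mul, cubicJacobi_mul_conj, map_natCast, hc, Nat.cast_pow, ← hchar,
      ringChar.Nat.cast_ringChar, zero_pow n.ne_zero]
  have hmax : (RingHom.ker φ).IsMaximal := RingHom.ker_isMaximal_of_surjective φ hφ
  have hmax' : (RingHom.ker φ').IsMaximal := RingHom.ker_isMaximal_of_surjective φ' hφ'
  have h0 : φ' (cubicJacobi φ h3) ≠ 0 := by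
    intro h
    refine hker (hmax.eq_of_le hmax'.ne_top ?_)
    rwa [← hJ, Ideal.span_singleton_le_iff_mem, RingHom.mem_ker]
  have hconj := (mul_eq_zero.1 hq).resolve_left h0
  -- Here `#F` is prime and `J̄` has norm `#F`, so `J̄` generates a maximal ideal, which must be the
  -- kernel of `φ'`.
  have hspan : Ideal.span {cubicJacobiConj φ h3} = Ideal.span {cubicJacobi φ' h3'} := by
    have hp : (Ideal.span {cubicJacobiConj φ h3}).IsPrime :=
      Ideal.isPrime_of_irreducible_absNorm (by rw [absNorm_cubicJacobiConj]; exact hcard)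
    have hm := hp.isMaximal (by simpa using cubicJacobiConj_ne_zero φ h3)
    rw [hJ']
    refine hm.eq_of_le hmax'.ne_top ?_
    rwa [Ideal.span_singleton_le_iff_mem, RingHom.mem_ker]
  -- Both are generators congruent to `-1` modulo `3`, so they are equal. Each side of the
  -- reciprocity law is then the character of a prime at its conjugate, and equals `1`.
  have heq : cubicJacobi φ' h3' = cubicJacobiConj φ h3 := by
    have h := eq_neg_of_span_eq (x := -cubicJacobiConj φ h3) (y := cubicJacobi φ' h3') ?_
      (three_dvd_cubicJacobi_add_one φ' h3') (by rw [Ideal.span_singleton_neg, hspan])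
    · exact (neg_injective h).symm
    · have := three_dvd_cubicJacobiConj_add_one φ h3
      rw [← neg_add', dvd_neg]
      exact this
  have heq' : cubicJacobiConj φ' h3' = cubicJacobi φ h3 := by
    apply toCHom_injective
    rw [← conj_toCHom_cubicJacobi', heq, ← conj_toCHom_cubicJacobi', Complex.conj_conj]
  have hne : Ideal.span {cubicJacobi φ h3} ≠ Ideal.span {cubicJacobiConj φ h3} := by
    rw [hspan, hJ, hJ']
    exact hker
  rw [heq, cubicChar_cubicJacobiConj h3 hφ hne, ← heq', cubicChar_cubicJacobiConj h3' hφ']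
  rw [heq, heq']
  exact hne.symm

/-! ### Point counts and changes of variables over a finite field. -/

section PointCount

variable {F : Type*} [Field F]

/-- The affine points of an elliptic curve together with the point at infinity. -/
def pointEquivOption {W : WeierstrassCurve F} (hΔ : W.Δ ≠ 0) :
    W.toAffine.Point ≃ Option {p : F × F // W.toAffine.Equation p.1 p.2} where
  toFun
    | .zero => none
    | .some x y h => some ⟨(x, y), h.1⟩
  invFun
    | none => .zero
    | some p => .some p.1.1 p.1.2
        ((WeierstrassCurve.Affine.equation_iff_nonsingular_of_Δ_ne_zero hΔ).1 p.2)
  left_inv := by rintro (_ | _) <;> rfl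
  right_inv := by rintro (_ | _) <;> rfl

theorem card_point [Finite F] {W : WeierstrassCurve F} (hΔ : W.Δ ≠ 0) :
    Nat.card W.toAffine.Point = Nat.card {p : F × F // W.toAffine.Equation p.1 p.2} + 1 := by
  rw [Nat.card_congr (pointEquivOption hΔ), Finite.card_option]

theorem equation_smul_iff (C : WeierstrassCurve.VariableChange F) (W : WeierstrassCurve F)
    (x y : F) : (C • W).toAffine.Equation x y ↔
      W.toAffine.Equation (C.u ^ 2 * x + C.r) (C.u ^ 3 * y + C.u ^ 2 * C.s * x + C.t) := by
  have hu : (C.u : F) ≠ 0 := C.u.ne_zero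
  rw [WeierstrassCurve.Affine.equation_iff', WeierstrassCurve.Affine.equation_iff',
    ← mul_eq_zero_iff_left (pow_ne_zero 6 hu)]
  refine Eq.congr ?_ rfl
  simp only [WeierstrassCurve.variableChange_a₁, WeierstrassCurve.variableChange_a₂,
    WeierstrassCurve.variableChange_a₃, WeierstrassCurve.variableChange_a₄,
    WeierstrassCurve.variableChange_a₆, Units.val_inv_eq_inv_val]
  field_simp
  ring

/-- The coordinate change of the plane given by an admissible change of variables. -/
def planeEquiv (C : WeierstrassCurve.VariableChange F) : F × F ≃ F × F where
  toFun p := (C.u ^ 2 * p.1 + C.r, C.u ^ 3 * p.2 + C.u ^ 2 * C.s * p.1 + C.t)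
  invFun p := ((p.1 - C.r) / C.u ^ 2, (p.2 - C.s * (p.1 - C.r) - C.t) / C.u ^ 3)
  left_inv p := by
    have hu : (C.u : F) ≠ 0 := C.u.ne_zero
    ext
    · simp only
      field_simp
      ring
    · simp only
      field_simp
      ring
  right_inv p := by
    have hu : (C.u : F) ≠ 0 := C.u.ne_zero
    ext
    · simp only
      field_simp
      ring
    · simp only
      field_simp
      ring

theorem card_point_smul [Finite F] (C : WeierstrassCurve.VariableChange F)
    {W : WeierstrassCurve F} (hΔ : W.Δ ≠ 0) :
    Nat.card (C • W).toAffine.Point = Nat.card W.toAffine.Point := by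
  have hΔ' : (C • W).Δ ≠ 0 := by
    rw [WeierstrassCurve.variableChange_Δ]
    exact mul_ne_zero (pow_ne_zero _ (Units.ne_zero _)) hΔ
  rw [card_point hΔ, card_point hΔ']
  have h : ∀ p : F × F, (C • W).toAffine.Equation p.1 p.2 ↔
      W.toAffine.Equation (planeEquiv C p).1 (planeEquiv C p).2 :=
    fun p => equation_smul_iff C W p.1 p.2
  rw [Nat.card_congr ((planeEquiv C).subtypeEquiv
    (q := fun p : F × F => W.toAffine.Equation p.1 p.2) h)]

end PointCount

/-! ### Integrality of changes of variables between models with unit discriminant. -/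

section IntegralChange

variable {R : Type*} [CommRing R] [IsDomain R] [IsIntegrallyClosed R]
  {L : Type*} [Field L] [Algebra R L] [IsFractionRing R L]

open Polynomial in
omit [IsDomain R] in
theorem exists_algebraMap_eq_of_quartic {x : L} (b c : R)
    (h : x ^ 4 + algebraMap R L b * x + algebraMap R L c = 0) : ∃ y : R, algebraMap R L y = x := by
  refine IsIntegrallyClosed.isIntegral_iff.1 ⟨X ^ 4 + C b * X + C c, by monicity!, ?_⟩
  simpa using h

open Polynomial in
omit [IsDomain R] in
theorem exists_algebraMap_eq_of_quadratic {x : L} (b c : R)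
    (h : x ^ 2 + algebraMap R L b * x + algebraMap R L c = 0) : ∃ y : R, algebraMap R L y = x := by
  refine IsIntegrallyClosed.isIntegral_iff.1 ⟨X ^ 2 + C b * X + C c, by monicity!, ?_⟩
  simpa using h

/-- The curve `y² + ay = x³`. -/
def cubicTwist {A : Type*} [CommRing A] (a : A) : WeierstrassCurve A := ⟨0, 0, a, 0, 0⟩

theorem cubicTwist_Δ {A : Type*} [CommRing A] (a : A) : (cubicTwist a).Δ = -27 * a ^ 4 := by
  simp only [cubicTwist, WeierstrassCurve.Δ, WeierstrassCurve.b₂, WeierstrassCurve.b₄,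
    WeierstrassCurve.b₆, WeierstrassCurve.b₈]
  ring

theorem cubicTwist_map {A B : Type*} [CommRing A] [CommRing B] (f : A →+* B) (a : A) :
    (cubicTwist a).map f = cubicTwist (f a) := by
  ext <;> simp [cubicTwist]

omit [IsDomain R] in
/-- An isomorphism between two integral models with unit discriminants is integral, here for the
model `y² + ay = x³` when `3` is invertible. -/
theorem exists_integral_variableChange {a : R} (h3 : IsUnit (3 : R)) (ha : IsUnit a)
    {M : WeierstrassCurve R} (hM : IsUnit M.Δ) (C : WeierstrassCurve.VariableChange L)
    (h : C • (cubicTwist a).map (algebraMap R L) = M.map (algebraMap R L)) :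
    ∃ C₀ : WeierstrassCurve.VariableChange R, C₀ • cubicTwist a = M := by
  have hinj : Function.Injective (algebraMap R L) := IsFractionRing.injective R L
  have hΔ : IsUnit (cubicTwist a).Δ := by
    rw [cubicTwist_Δ, show (-27 : R) = -(3 ^ 3) by norm_num]
    exact (h3.pow 3).neg.mul (ha.pow 4)
  have eΔ := congrArg WeierstrassCurve.Δ h
  have eb := congrArg WeierstrassCurve.b₈ h
  have e2 := congrArg WeierstrassCurve.a₂ h
  have e6 := congrArg WeierstrassCurve.a₆ h
  rw [WeierstrassCurve.variableChange_Δ, WeierstrassCurve.map_Δ, WeierstrassCurve.map_Δ] at eΔ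
  obtain ⟨Δ₀, hΔ₀⟩ := hΔ
  obtain ⟨Δ₁, hΔ₁⟩ := hM
  rw [← hΔ₀, ← hΔ₁] at eΔ
  have hu : (C.u : L) ≠ 0 := C.u.ne_zero
  have hcancel (w : Rˣ) : algebraMap R L w * algebraMap R L (w⁻¹ : Rˣ) = 1 := by
    rw [← map_mul, Units.mul_inv, map_one]
  rw [Units.val_inv_eq_inv_val] at eΔ
  -- The power `u¹²` is a quotient of two unit discriminants, so `u` and `u⁻¹` are both integral.
  obtain ⟨u, hu'⟩ : ∃ u : R, algebraMap R L u = C.u := by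
    refine IsIntegrallyClosed.exists_algebraMap_eq_of_isIntegral_pow (n := 12) (by norm_num) ?_
    have : (C.u : L) ^ 12 = algebraMap R L (Δ₀ * (Δ₁⁻¹ : Rˣ)) := by
      rw [map_mul]
      have h1 := hcancel Δ₁
      rw [← eΔ] at h1
      field_simp at h1
      exact h1.symm
    rw [this]
    exact isIntegral_algebraMap
  obtain ⟨v, hv'⟩ : ∃ v : R, algebraMap R L v = (C.u : L)⁻¹ := by
    refine IsIntegrallyClosed.exists_algebraMap_eq_of_isIntegral_pow (n := 12) (by norm_num) ?_
    have : (C.u : L)⁻¹ ^ 12 = algebraMap R L (Δ₁ * (Δ₀⁻¹ : Rˣ)) := by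
      rw [map_mul, ← eΔ, mul_assoc, hcancel, mul_one]
    rw [this]
    exact isIntegral_algebraMap
  have huv : u * v = 1 := hinj (by rw [map_mul, hu', hv', map_one, mul_inv_cancel₀ hu])
  let u₀ : Rˣ := ⟨u, v, huv, by rw [mul_comm]; exact huv⟩
  obtain ⟨w3, hw3⟩ := h3
  have h3inv : (3 : L) * algebraMap R L (w3⁻¹ : Rˣ) = 1 := by
    rw [← map_ofNat (algebraMap R L) 3, ← hw3]
    exact hcancel w3
  rw [cubicTwist_map] at eb e2 e6
  rw [WeierstrassCurve.variableChange_b₈, WeierstrassCurve.map_b₈,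
    Units.val_inv_eq_inv_val] at eb
  rw [WeierstrassCurve.variableChange_a₂, WeierstrassCurve.map_a₂,
    Units.val_inv_eq_inv_val] at e2
  rw [WeierstrassCurve.variableChange_a₆, WeierstrassCurve.map_a₆,
    Units.val_inv_eq_inv_val] at e6
  simp only [cubicTwist, WeierstrassCurve.b₂, WeierstrassCurve.b₄, WeierstrassCurve.b₆,
    WeierstrassCurve.b₈] at eb e2 e6
  -- The transformation rule of `b₈` reads `3r⁴ + 3a²r = u⁸ b₈(M)`, which is monic in `r` after
  -- division by the unit `3`. The rules of `a₂` and `a₆` then give monic quadratic equations for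
  -- `s` and `t`.
  obtain ⟨r, hr⟩ : ∃ r : R, algebraMap R L r = C.r := by
    refine exists_algebraMap_eq_of_quartic (a ^ 2) (-((w3⁻¹ : Rˣ) * (u ^ 8 * M.b₈))) ?_
    have e : (C.u : L) ^ 8 * algebraMap R L M.b₈ =
        3 * C.r * algebraMap R L a ^ 2 + 3 * C.r ^ 4 := by
      rw [WeierstrassCurve.b₈, ← eb]
      field_simp
      ring
    rw [map_neg, map_mul, map_mul, map_pow, map_pow, hu', e]
    linear_combination (-(C.r * algebraMap R L a ^ 2) - C.r ^ 4) * h3inv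
  obtain ⟨s, hs⟩ : ∃ s : R, algebraMap R L s = C.s := by
    refine IsIntegrallyClosed.exists_algebraMap_eq_of_isIntegral_pow (n := 2) (by norm_num) ?_
    have e : C.s ^ 2 = algebraMap R L (3 * r - u ^ 2 * M.a₂) := by
      rw [map_sub, map_mul, map_mul, map_pow, hr, hu', ← e2, map_ofNat]
      field_simp
      ring
    rw [e]
    exact isIntegral_algebraMap
  obtain ⟨t, ht⟩ : ∃ t : R, algebraMap R L t = C.t := by
    refine exists_algebraMap_eq_of_quadratic a (u ^ 6 * M.a₆ - r ^ 3) ?_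
    rw [map_sub, map_mul, map_pow, map_pow, hu', hr, ← e6]
    field_simp
    ring
  refine ⟨⟨u₀, r, s, t⟩, WeierstrassCurve.map_injective hinj ?_⟩
  change (_ • _ : WeierstrassCurve R).map _ = M.map _
  rw [← h, ← WeierstrassCurve.map_variableChange]
  congr 1
  ext
  · exact hu'
  · exact hr
  · exact hs
  · exact ht

end IntegralChange

/-! ### Local polynomials for good and additive reduction. -/

section LocalPolynomial

variable (R : Type*) [CommRing R] [IsDomain R] [IsDiscreteValuationRing R] {L : Type*}
  [Field L] [Algebra R L] [IsFractionRing R L]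

open IsDiscreteValuationRing IsDedekindDomain.HeightOneSpectrum

omit [IsDiscreteValuationRing R] in
theorem isUnit_of_valuation_eq_one [IsDiscreteValuationRing R] {x : R}
    (h : valuation L (maximalIdeal R) (algebraMap R L x) = 1) : IsUnit x := by
  rw [valuation_eq_one_iff_notMem] at h
  by_contra hx
  exact h hx

theorem valuation_eq_one_of_isUnit {x : R} (h : IsUnit x) :
    valuation L (maximalIdeal R) (algebraMap R L x) = 1 := by
  rw [valuation_eq_one_iff_notMem]
  exact fun hx => hx h

/-- The minimal model has good reduction as soon as some integral model has unit discriminant. -/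
theorem hasGoodReduction_minimal {W : WeierstrassCurve L} {W₀ : WeierstrassCurve R}
    (hΔ : IsUnit W₀.Δ) (C : WeierstrassCurve.VariableChange L)
    (h : C • W = W₀.map (algebraMap R L)) : (W.minimal R).HasGoodReduction R := by
  refine ⟨?_⟩
  have hmin : (W.minimal R).IsMinimal R := inferInstance
  have hmax := hmin.val_Δ_maximal
  set C₁ := (W.exists_isMinimal R).choose
  have hC : (C * C₁⁻¹) • W.minimal R = W₀.map (algebraMap R L) := by
    rw [mul_smul, WeierstrassCurve.minimal, inv_smul_smul, h]
  have hint : ((C * C₁⁻¹) • W.minimal R).IsIntegral R := ⟨⟨W₀, hC⟩⟩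
  have hle := hmax.2 hint
  have hval : (WeierstrassCurve.valuation_Δ_aux R ((C * C₁⁻¹) • W.minimal R) :
      WithZero (Multiplicative ℤ)) = 1 := by
    rw [WeierstrassCurve.valuation_Δ_aux_eq_of_isIntegral, hC, WeierstrassCurve.map_Δ]
    exact valuation_eq_one_of_isUnit R hΔ
  -- Valuations are multiplicative here: `1` is the largest possible value on integral models, so
  -- maximality forces the minimal model to attain it.
  have h1 : WeierstrassCurve.valuation_Δ_aux R ((1 : WeierstrassCurve.VariableChange L) •
      W.minimal R) ≤ WeierstrassCurve.valuation_Δ_aux R ((C * C₁⁻¹) • W.minimal R) := by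
    rw [← Subtype.coe_le_coe, hval]
    exact (WeierstrassCurve.valuation_Δ_aux R _).2
  have h2 := hle h1
  beta_reduce at h2
  rw [← Subtype.coe_le_coe, hval, one_smul,
    WeierstrassCurve.valuation_Δ_aux_eq_of_isIntegral] at h2
  refine le_antisymm ?_ h2
  rw [← WeierstrassCurve.integralModel_Δ_eq R (W.minimal R)]
  exact valuation_le_one _ _

-- The local polynomial refers to a chosen minimal model. That model and `y² + ay = x³` both have
-- unit discriminant, so they are isomorphic over `R` and their reductions have equally many points.
open Polynomial in
theorem localPolynomial_of_cubicTwist [Finite (IsLocalRing.ResidueField R)]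
    {W : WeierstrassCurve L} {a : R} (h3 : IsUnit (3 : R))
    (ha : IsUnit a) (C : WeierstrassCurve.VariableChange L)
    (h : C • W = (cubicTwist a).map (algebraMap R L)) :
    W.localPolynomial R =
      1 - Polynomial.C ((Nat.card (IsLocalRing.ResidueField R) : ℤ) + 1 -
          Nat.card (cubicTwist (IsLocalRing.residue R a)).toAffine.Point) * X +
        Polynomial.C (Nat.card (IsLocalRing.ResidueField R) : ℤ) * X ^ 2 := by
  have hΔ : IsUnit (cubicTwist a).Δ := by
    rw [cubicTwist_Δ, show (-27 : R) = -(3 ^ 3) by norm_num]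
    exact (h3.pow 3).neg.mul (ha.pow 4)
  have hgood := hasGoodReduction_minimal R hΔ C h
  set C₁ := (W.exists_isMinimal R).choose with hC₁
  have hM : IsUnit ((W.minimal R).integralModel R).Δ := by
    refine isUnit_of_valuation_eq_one R (L := L) ?_
    rw [WeierstrassCurve.integralModel_Δ_eq]
    exact hgood.goodReduction
  obtain ⟨C₀, hC₀⟩ := exists_integral_variableChange h3 ha hM (C₁ * C⁻¹) (by
    rw [← h, mul_smul, inv_smul_smul]
    exact (WeierstrassCurve.baseChange_integralModel_eq R (W.minimal R)).symm)
  have hcard : Nat.card ((W.minimal R).reduction R).toAffine.Point =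
      Nat.card (cubicTwist (IsLocalRing.residue R a)).toAffine.Point := by
    rw [WeierstrassCurve.reduction, ← hC₀, ← WeierstrassCurve.map_variableChange, cubicTwist_map]
    refine card_point_smul _ ?_
    rw [← cubicTwist_map, WeierstrassCurve.map_Δ]
    exact (hΔ.map (IsLocalRing.residue R)).ne_zero
  rw [WeierstrassCurve.localPolynomial, if_pos hgood, hcard]

/-- A change of variables multiplies the discriminant by a twelfth power, so `hΔ` rules out good
reduction; multiplicative reduction would need `c₄` to be a unit. -/
theorem localPolynomial_eq_one {W : WeierstrassCurve L} (hc₄ : W.c₄ = 0)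
    (hΔ : ∀ (u : L) (r : R), IsUnit r → u ^ 12 * W.Δ ≠ algebraMap R L r) :
    W.localPolynomial R = 1 := by
  set C₁ := (W.exists_isMinimal R).choose with hC₁
  have hgood : ¬ (W.minimal R).HasGoodReduction R := by
    intro h
    refine hΔ (C₁.u⁻¹ : Lˣ) ((W.minimal R).integralModel R).Δ ?_ ?_
    · refine isUnit_of_valuation_eq_one R (L := L) ?_
      rw [WeierstrassCurve.integralModel_Δ_eq]
      exact h.goodReduction
    · rw [WeierstrassCurve.integralModel_Δ_eq]
      exact (WeierstrassCurve.variableChange_Δ W C₁).symm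
  have hmul : ¬ (W.minimal R).HasMultiplicativeReduction R := by
    intro h
    have h1 := h.multiplicativeReduction
    have h2 : (W.minimal R).c₄ = 0 := by
      refine (WeierstrassCurve.variableChange_c₄ W C₁).trans ?_
      rw [hc₄, mul_zero]
    rw [h2, map_zero] at h1
    exact zero_ne_one h1
  have hsplit : ¬ (W.minimal R).HasSplitMultiplicativeReduction R :=
    fun h => hmul h.toHasMultiplicativeReduction
  rw [WeierstrassCurve.localPolynomial, if_neg hgood, if_neg hsplit, if_neg hmul]

end LocalPolynomial

/-! ### Counting points on `y² + ay = x³` with the cubic character. -/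

section CountCubes

variable {F : Type*} [Field F] [Fintype F] (φ : 𝓞 K →+* F) (h3 : (3 : F) ≠ 0)

include φ h3 in
theorem exists_cube_of_pow_eq_one {c : F} (hc : c ≠ 0) (h : c ^ ((Fintype.card F - 1) / 3) = 1) :
    ∃ y : F, y ^ 3 = c := by
  classical
  obtain ⟨g, hg⟩ := IsCyclic.exists_generator (α := Fˣ)
  have hord := orderOf_eq_card_of_forall_mem_zpowers hg
  rw [Nat.card_eq_fintype_card, Fintype.card_units] at hord
  have h1 := three_mul_card_sub_one_div φ h3
  have h2 := card_sub_one_div_pos φ h3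
  obtain ⟨k, hk⟩ := (mem_powers_iff_mem_zpowers).2 (hg (Units.mk0 c hc))
  have hk' : g ^ k = Units.mk0 c hc := hk
  have h4 : g ^ (k * ((Fintype.card F - 1) / 3)) = 1 := by
    rw [pow_mul, hk']
    ext
    simpa using h
  have h5 := orderOf_dvd_of_pow_eq_one h4
  rw [hord] at h5
  obtain ⟨j, rfl⟩ : 3 ∣ k := Nat.dvd_of_mul_dvd_mul_right h2 (by rwa [h1])
  refine ⟨(g : F) ^ j, ?_⟩
  have := congrArg Units.val hk'
  rw [Units.val_pow_eq_pow_val, Units.val_mk0] at this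
  rw [← pow_mul, mul_comm, this]

open Classical in
/-- The number of cube roots of `c`, in terms of the cubic character. -/
theorem card_cubeRoots (c : F) : ((Finset.univ.filter fun x : F => x ^ 3 = c).card : 𝓞 K) =
    1 + cubicChar φ h3 c + cubicChar φ h3 c ^ 2 := by
  by_cases hc : c = 0
  · subst hc
    have : (Finset.univ.filter fun x : F => x ^ 3 = 0) = {0} := by
      ext x
      simp
    rw [this, Finset.card_singleton, MulChar.map_zero]
    simp
  have hprim := isPrimitiveRoot_map_rhoInt φ h3
  have hset : (Finset.univ.filter fun x : F => x ^ 3 = c) = Polynomial.nthRootsFinset 3 c := by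
    ext x
    rw [Polynomial.mem_nthRootsFinset (by norm_num)]
    simp
  have hcard : (Polynomial.nthRootsFinset 3 c).card = if ∃ α, α ^ 3 = c then 3 else 0 := by
    rw [Polynomial.nthRootsFinset_def, Multiset.toFinset_card_of_nodup
      (hprim.nthRoots_nodup hc), hprim.card_nthRoots]
    congr
  rw [hset, hcard]
  split_ifs with h
  · obtain ⟨y, rfl⟩ := h
    have hy : y ≠ 0 := by
      rintro rfl
      exact hc (by simp)
    rw [map_pow, cubicChar_pow_three φ h3 hy]
    norm_num
  · have h1 : cubicChar φ h3 c ≠ 1 := by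
      intro h1
      refine h (exists_cube_of_pow_eq_one φ h3 hc ?_)
      rw [← map_cubicChar φ h3, h1, map_one]
    have h2 := cubicChar_pow_three φ h3 hc
    have h4 : (cubicChar φ h3 c - 1) * (1 + cubicChar φ h3 c + cubicChar φ h3 c ^ 2) = 0 := by
      linear_combination h2
    rw [Nat.cast_zero]
    exact ((mul_eq_zero.1 h4).resolve_left (sub_ne_zero.2 h1)).symm

/-- Substituting `y = -az` gives `y² + ay = -a² z(1 - z)`. -/
theorem sum_cubicChar_mul_add {a : F} (ha : a ≠ 0) (χ : MulChar F (𝓞 K)) :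
    ∑ y : F, χ (y ^ 2 + a * y) = χ (-1) * χ a ^ 2 * jacobiSum χ χ := by
  rw [jacobiSum, Finset.mul_sum, ← Equiv.sum_comp (Equiv.mulLeft₀ (-a) (neg_ne_zero.2 ha))]
  refine Finset.sum_congr rfl fun z _ => ?_
  rw [← map_pow χ, ← map_mul, ← map_mul, ← map_mul]
  refine congrArg χ ?_
  change (-a * z) ^ 2 + a * (-a * z) = _
  ring

open Classical in
/-- The number of points of `y² + ay = x³` over a finite field. -/
theorem card_point_cubicTwist {a : F} (ha : a ≠ 0) :
    (Nat.card (cubicTwist a).toAffine.Point : 𝓞 K) =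
      Fintype.card F + 1 + cubicChar φ h3 a ^ 2 * cubicJacobi φ h3 +
        cubicChar φ h3 a * cubicJacobiConj φ h3 := by
  have hΔ : (cubicTwist a).Δ ≠ 0 := by
    rw [cubicTwist_Δ, show (-27 : F) = -(3 ^ 3) by norm_num]
    exact mul_ne_zero (neg_ne_zero.2 (pow_ne_zero _ h3)) (pow_ne_zero _ ha)
  have hcount : Nat.card {p : F × F // (cubicTwist a).toAffine.Equation p.1 p.2} =
      ∑ y : F, (Finset.univ.filter fun x : F => x ^ 3 = y ^ 2 + a * y).card := by
    rw [Nat.card_eq_fintype_card, Fintype.card_subtype]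
    simp_rw [Finset.card_filter]
    rw [← Finset.univ_product_univ, Finset.sum_product_right]
    refine Finset.sum_congr rfl fun y _ => Finset.sum_congr rfl fun x _ => ?_
    congr 1
    rw [WeierstrassCurve.Affine.equation_iff]
    simp only [cubicTwist, zero_mul, add_zero]
    exact propext eq_comm
  have hchi2 : ∀ x, cubicChar φ h3 x ^ 2 = (cubicChar φ h3)⁻¹ x :=
    fun x => (inv_cubicChar_apply φ h3 x).symm
  have hcube := cubicChar_pow_three φ h3 ha
  rw [card_point hΔ, hcount]
  push_cast
  simp_rw [card_cubeRoots φ h3, Finset.sum_add_distrib, hchi2]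
  rw [sum_cubicChar_mul_add ha, sum_cubicChar_mul_add ha, inv_cubicChar_apply,
    inv_cubicChar_apply, cubicChar_neg_one, Finset.sum_const, Finset.card_univ, nsmul_eq_mul,
    cubicJacobi, cubicJacobiConj]
  -- The inverse character contributes `χ(a)⁴`, which is `χ(a)`.
  linear_combination (cubicChar φ h3 a *
    jacobiSum (cubicChar φ h3)⁻¹ (cubicChar φ h3)⁻¹) * hcube

end CountCubes

/-! ### The residue field of the completion at `P`. -/

section Completion

variable (P : HeightOneSpectrum (𝓞 K))

/-- Reduction of `ℤ[ρ]` modulo `P`, with values in the residue field of the completion. -/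
noncomputable def reductionHom :
    𝓞 K →+* IsLocalRing.ResidueField (P.adicCompletionIntegers K) :=
  (IsLocalRing.residue _).comp (algebraMap (𝓞 K) (P.adicCompletionIntegers K))

theorem valued_algebraMap (x : 𝓞 K) :
    Valued.v ((algebraMap (𝓞 K) (P.adicCompletionIntegers K) x : P.adicCompletionIntegers K) :
      P.adicCompletion K) = P.intValuation x := by
  rw [← P.valuation_of_algebraMap (K := K)]
  exact HeightOneSpectrum.valuedAdicCompletion_eq_valuation' P _

theorem residue_eq_zero_iff_valued_lt_one (x : P.adicCompletionIntegers K) :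
    IsLocalRing.residue _ x = 0 ↔ Valued.v (x : P.adicCompletion K) < 1 := by
  rw [IsLocalRing.residue_eq_zero_iff, IsLocalRing.mem_maximalIdeal, mem_nonunits_iff,
    HeightOneSpectrum.adicCompletionIntegers.isUnit_iff_valued_eq_one]
  exact ⟨fun h => lt_of_le_of_ne x.2 h, fun h => h.ne⟩

theorem ker_reductionHom : RingHom.ker (reductionHom P) = P.asIdeal := by
  ext x
  rw [RingHom.mem_ker, reductionHom, RingHom.comp_apply, residue_eq_zero_iff_valued_lt_one,
    valued_algebraMap, P.intValuation_lt_one_iff_mem]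

theorem reductionHom_surjective : Function.Surjective (reductionHom P) := by
  intro y
  obtain ⟨y, rfl⟩ := IsLocalRing.residue_surjective y
  -- A class is lifted in two approximations: by an element `k` of `K`, by density, and then `k`,
  -- being integral at `P`, by an element of `ℤ[ρ]`.
  have hopen : IsOpen {z : P.adicCompletion K | Valued.v ((y : P.adicCompletion K) - z) < 1} := by
    have h1 := Valued.isOpen_ball (P.adicCompletion K) 1
    simp only [Valuation.restrict_lt_one_iff] at h1
    exact h1.preimage (continuous_const.sub continuous_id)
  obtain ⟨k, hk⟩ := (HeightOneSpectrum.denseRange_algebraMap (K := K) P).exists_mem_open hopen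
    ⟨y, by simp⟩
  have hk' : Valued.v ((y : P.adicCompletion K) - algebraMap K (P.adicCompletion K) k) < 1 := hk
  have hvk : P.valuation K k ≤ 1 := by
    rw [← HeightOneSpectrum.valuedAdicCompletion_eq_valuation' P k]
    have h2 := Valuation.map_sub Valued.v (y : P.adicCompletion K)
      ((y : P.adicCompletion K) - algebraMap K (P.adicCompletion K) k)
    rw [sub_sub_cancel] at h2
    exact h2.trans (max_le y.2 hk'.le)
  obtain ⟨a, ha⟩ := P.exists_valuation_sub_lt_of_integer hvk 1
  refine ⟨a, ?_⟩
  rw [reductionHom, RingHom.comp_apply, ← sub_eq_zero, ← map_sub,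
    residue_eq_zero_iff_valued_lt_one]
  have h4 : Valued.v (algebraMap K (P.adicCompletion K) (algebraMap (𝓞 K) K a - k)) < 1 := by
    rw [show Valued.v (algebraMap K (P.adicCompletion K) (algebraMap (𝓞 K) K a - k)) = _ from
      HeightOneSpectrum.valuedAdicCompletion_eq_valuation' P _]
    simpa using ha
  have h5 := (Valuation.map_sub Valued.v
    (algebraMap K (P.adicCompletion K) (algebraMap (𝓞 K) K a - k))
    ((y : P.adicCompletion K) - algebraMap K (P.adicCompletion K) k)).trans_lt (max_lt h4 hk')
  refine lt_of_eq_of_lt (congrArg _ ?_) h5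
  rw [map_sub]
  change algebraMap K (P.adicCompletion K) (algebraMap (𝓞 K) K a) - y = _
  ring

instance finite_residueField :
    Finite (IsLocalRing.ResidueField (P.adicCompletionIntegers K)) := by
  have : Finite (𝓞 K ⧸ P.asIdeal) := Ideal.finiteQuotientOfFreeOfNeBot _ P.ne_bot
  exact Finite.of_surjective _
    (Ideal.Quotient.lift_surjective_of_surjective P.asIdeal (f := reductionHom P)
      (fun x hx => by rwa [← RingHom.mem_ker, ker_reductionHom]) (reductionHom_surjective P))

end Completion

/-! ### Summability over prime ideals. -/

open Filter Asymptotics in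
theorem summable_absNorm_rpow {t : ℝ} (ht : 1 < t) :
    Summable fun P : HeightOneSpectrum (𝓞 K) => (Ideal.absNorm P.asIdeal : ℝ) ^ (-t) := by
  have hO : (fun n : ℕ => ∑ k ∈ Finset.Icc 1 n,
      (Nat.card {I : Ideal (𝓞 K) // Ideal.absNorm I = k} : ℝ)) =O[atTop]
        fun n : ℕ => (n : ℝ) ^ (1 : ℝ) := by
    -- The number of nonzero ideals of norm at most `n` is `O(n)`, so the Dirichlet series counting
    -- ideals by norm converges absolutely to the right of `1`. Grouping the primes by norm bounds
    -- their sum by this series.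
    have h := ((Ideal.tendsto_norm_le_div_atTop₀ K).comp tendsto_natCast_atTop_atTop).isBigO_one ℝ
    have h2 := h.mul (isBigO_refl (fun n : ℕ => (n : ℝ)) atTop)
    refine (h2.congr' ?_ (Eventually.of_forall fun n => by simp))
    filter_upwards [eventually_gt_atTop 0] with n hn
    have hn' : (n : ℝ) ≠ 0 := by positivity
    simp only [Function.comp_apply, Nat.cast_le, ← Nat.cast_sum]
    rw [div_mul_cancel₀ _ hn']
    congr 1
    -- The zero ideal, the only one of norm `0`, is added to both sides so that the sum starts at
    -- `0`.
    rw [← add_left_inj 1, ← Ideal.card_norm_le_eq_card_norm_le_add_one,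
      show Finset.Icc 1 n = Finset.Ioc 0 n from Finset.Icc_succ_left_eq_Ioc _ _,
      show 1 = Nat.card {I : Ideal (𝓞 K) // Ideal.absNorm I = 0} by
        simp [Ideal.absNorm_eq_zero_iff],
      Finset.sum_Ioc_add_eq_sum_Icc (n.zero_le),
      ← Finset.card_preimage_eq_sum_card_image_eq
        (fun k _ ↦ Ideal.finite_setOfPred_absNorm_eq k)]
    simp [Set.coe_eq_subtype]
  have hL := LSeriesSummable_of_sum_norm_bigO_and_nonneg (s := (t : ℂ)) hO
    (fun n => Nat.cast_nonneg _) zero_le_one (by simpa using ht)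
  have hS : Summable fun n : ℕ =>
      (Nat.card {I : Ideal (𝓞 K) // Ideal.absNorm I = n} : ℝ) * (n : ℝ) ^ (-t) := by
    refine hL.norm.congr_cofinite ?_
    rw [Nat.cofinite_eq_atTop]
    filter_upwards [eventually_gt_atTop 0] with n hn
    rw [LSeries.term_of_ne_zero hn.ne', norm_div, Complex.norm_natCast_cpow_of_pos hn,
      Real.rpow_neg (Nat.cast_nonneg _), div_eq_mul_inv]
    simp
  let f : HeightOneSpectrum (𝓞 K) → ℕ := fun P => Ideal.absNorm P.asIdeal
  rw [← (Equiv.sigmaFiberEquiv f).summable_iff]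
  let ι (n : ℕ) : {P // f P = n} → {I : Ideal (𝓞 K) // Ideal.absNorm I = n} :=
    fun P => ⟨P.1.asIdeal, P.2⟩
  have hι (n : ℕ) : Function.Injective (ι n) := fun P Q h =>
    Subtype.ext (HeightOneSpectrum.ext (Subtype.ext_iff.1 h))
  have hfinI (n : ℕ) : Finite {I : Ideal (𝓞 K) // Ideal.absNorm I = n} :=
    Ideal.finite_setOfPred_absNorm_eq n
  have hfin (n : ℕ) : Finite {P // f P = n} := Finite.of_injective _ (hι n)
  have hterm (n : ℕ) (P : {P // f P = n}) :
      (Ideal.absNorm (P : HeightOneSpectrum (𝓞 K)).asIdeal : ℝ) ^ (-t) = (n : ℝ) ^ (-t) := by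
    rw [show Ideal.absNorm (P : HeightOneSpectrum (𝓞 K)).asIdeal = n from P.2]
  refine (summable_sigma_of_nonneg fun x => by
    simp only [Function.comp_apply]; positivity).2 ⟨fun n => Summable.of_finite, ?_⟩
  refine hS.of_nonneg_of_le (fun n => tsum_nonneg fun x => by
    simp only [Function.comp_apply]; positivity) fun n => ?_
  simp only [Function.comp_apply, Equiv.sigmaFiberEquiv_apply, hterm, tsum_const, nsmul_eq_mul]
  exact mul_le_mul_of_nonneg_right (Nat.cast_le.2 (Nat.card_le_card_of_injective _ (hι n)))
    (by positivity)

/-! ### The characters `χ_λ`, `χ₀`, `χ₀'`, `χ₁` and independence of the generator. -/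

section Characters

theorem norm_toC_residueRep_le {S : Set (𝓞 K)} (hS : ∀ w ∈ S, ‖toCHom w‖ = 1) (m a : 𝓞 K) :
    ‖toC (residueRep S m a)‖ ≤ 1 := by
  rw [toC_eq_toCHom]
  by_cases h : ∃ w ∈ S, m ∣ a - w
  · rw [residueRep, dif_pos h, hS _ h.choose_spec.1]
  · rw [residueRep_eq_zero h, map_zero, norm_zero]
    exact zero_le_one

theorem residueRep_congr {S : Set (𝓞 K)} {m a b : 𝓞 K}
    (hS : ∀ x ∈ S, ∀ y ∈ S, m ∣ x - y → x = y) (h : m ∣ a - b) :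
    residueRep S m a = residueRep S m b := by
  have h1 (w) : m ∣ a - w ↔ m ∣ b - w := by
    rw [← dvd_add_right (c := b - w) h]
    simp
  by_cases hex : ∃ w ∈ S, m ∣ b - w
  · obtain ⟨w, hw, hb⟩ := hex
    rw [residueRep_eq hS hw hb, residueRep_eq hS hw ((h1 w).2 hb)]
  · rw [residueRep_eq_zero hex, residueRep_eq_zero]
    simpa only [h1] using hex

theorem sixthRoots_incongruent : ∀ x ∈ {w : 𝓞 K | w ^ 6 = 1}, ∀ y ∈ {w : 𝓞 K | w ^ 6 = 1},
    (3 : 𝓞 K) ∣ x - y → x = y := fun _ hx _ hy h =>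
  eq_of_dvd_sub (by rw [absNorm_span_three]; norm_num)
    (norm_toCHom_of_pow_eq_one (by norm_num) hx) (norm_toCHom_of_pow_eq_one (by norm_num) hy) h

theorem not_sqrtNegThree_dvd_two : ¬ (1 + 2 * rhoInt) ∣ 2 := by
  intro h
  have h1 := dvd_sub sqrtNegThree_dvd_three h
  exact prime_sqrtNegThree.not_dvd_one (h1.trans (dvd_of_eq (by norm_num)))

theorem signs_incongruent : ∀ x ∈ ({1, -1} : Set (𝓞 K)), ∀ y ∈ ({1, -1} : Set (𝓞 K)),
    (1 + 2 * rhoInt) ∣ x - y → x = y := by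
  rintro x (rfl | rfl) y (rfl | rfl) h
  · rfl
  · exact absurd (h.trans (dvd_of_eq (by norm_num))) not_sqrtNegThree_dvd_two
  · refine absurd (((dvd_neg).2 h).trans (dvd_of_eq ?_)) not_sqrtNegThree_dvd_two
    norm_num
  · rfl

theorem chiZero_unit_mul (u : (𝓞 K)ˣ) (ν : 𝓞 K) : chiZero (u * ν) = toC u * chiZero ν := by
  rw [chiZero, residueRep_mul (v := ((u⁻¹ : (𝓞 K)ˣ) : 𝓞 K)) (Units.inv_mul u)
    sixthRoots_incongruent, toC_eq_toCHom, map_mul]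
  · rfl
  · intro x hx
    rw [Set.mem_ofPred_eq] at hx ⊢
    rw [mul_pow, hx, unit_pow_six, one_mul]
  · intro x hx
    rw [Set.mem_ofPred_eq] at hx ⊢
    rw [mul_pow, hx, unit_pow_six, one_mul]

theorem chiZero'_neg (ν : 𝓞 K) : chiZero' (-ν) = -chiZero' ν := by
  have hS : ∀ x ∈ ({1, -1} : Set (𝓞 K)), -1 * x ∈ ({1, -1} : Set (𝓞 K)) := by
    rintro x (rfl | rfl) <;> simp
  rw [chiZero', ← neg_one_mul ν, residueRep_mul (v := -1) (by norm_num) signs_incongruent hS hS,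
    toC_eq_toCHom, neg_one_mul, map_neg]
  rfl

theorem chiZero'_rhoInt_mul (ν : 𝓞 K) : chiZero' (rhoInt * ν) = chiZero' ν := by
  rw [chiZero', chiZero', residueRep_congr signs_incongruent]
  -- From `ρ - 1 = -ρ² (1 + 2ρ)`.
  refine ⟨-rhoInt ^ 2 * ν, ?_⟩
  linear_combination 2 * ν * isPrimitiveRoot_rhoInt.pow_eq_one + ν * rhoInt_sq_add

theorem chiZero_of_three_dvd {ν : 𝓞 K} (h : (3 : 𝓞 K) ∣ ν - 1) : chiZero ν = 1 := by
  rw [chiZero, residueRep_eq sixthRoots_incongruent (w := 1) (one_pow 6) h, toC_eq_toCHom, map_one]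

theorem chiZero'_of_three_dvd {ν : 𝓞 K} (h : (3 : 𝓞 K) ∣ ν - 1) : chiZero' ν = 1 := by
  rw [chiZero', residueRep_eq signs_incongruent (w := 1) (by simp)
    (sqrtNegThree_dvd_three.trans h), toC_eq_toCHom, map_one]

theorem chiZero_sqrtNegThree : chiZero (1 + 2 * rhoInt) = 0 := by
  rw [chiZero, residueRep_eq_zero, toC_eq_toCHom, map_zero]
  rintro ⟨w, hw, h⟩
  have h1 : (1 + 2 * rhoInt) ∣ w := by
    have := dvd_sub (dvd_refl (1 + 2 * rhoInt)) (sqrtNegThree_dvd_three.trans h)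
    rwa [sub_sub_cancel] at this
  have h2 := h1.trans (dvd_pow_self w (n := 6) (by norm_num))
  rw [show w ^ 6 = 1 from hw] at h2
  exact prime_sqrtNegThree.not_dvd_one h2

theorem chiZero'_sqrtNegThree : chiZero' (1 + 2 * rhoInt) = 0 := by
  rw [chiZero', residueRep_eq_zero, toC_eq_toCHom, map_zero]
  rintro ⟨w, hw, h⟩
  have h1 : (1 + 2 * rhoInt) ∣ w := by
    have := dvd_sub (dvd_refl (1 + 2 * rhoInt)) h
    rwa [sub_sub_cancel] at this
  have h2 := h1.trans (dvd_pow_self w (n := 2) (by norm_num))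
  have h4 : w ^ 2 = 1 := by
    rcases hw with rfl | rfl <;> norm_num
  rw [h4] at h2
  exact prime_sqrtNegThree.not_dvd_one h2

variable {l : ℕ} {lam : 𝓞 K}

theorem norm_chiOne_le (ν : 𝓞 K) : ‖chiOne l lam ν‖ ≤ 1 := by
  have h1 : ‖chiLam l lam ν‖ ≤ 1 :=
    norm_toC_residueRep_le (fun w hw => norm_toCHom_of_pow_eq_one (n := 3) (by norm_num) hw) _ _
  have h2 : ‖chiZero ν‖ ≤ 1 :=
    norm_toC_residueRep_le (fun w hw => norm_toCHom_of_pow_eq_one (n := 6) (by norm_num) hw) _ _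
  have h4 : ‖chiZero' ν‖ ≤ 1 := by
    refine norm_toC_residueRep_le (fun w hw => ?_) _ _
    rcases hw with rfl | rfl <;> simp
  unfold chiOne
  split_ifs
  · rw [norm_mul, RCLike.norm_conj]
    exact mul_le_one₀ h1 (norm_nonneg _) h2
  · rw [norm_mul]
    exact mul_le_one₀ h1 (norm_nonneg _) h4
  · simp

variable {F : Type*} [Field F] [Fintype F] {φ : 𝓞 K →+* F} (h3 : (3 : F) ≠ 0)

/-- The cubic residue character modulo `lam` is the one of the residue field. -/
theorem chiLam_eq (hker : RingHom.ker φ = Ideal.span {lam}) (hcard : Fintype.card F = l)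
    (hnorm : Ideal.absNorm (Ideal.span {lam}) = l) (hl : 4 < l) (ν : 𝓞 K) :
    chiLam l lam ν = toCHom (cubicChar φ h3 (φ ν)) := by
  have hmem : ∀ x y, lam ∣ x - y ↔ φ x = φ y := fun x y => by
    rw [← sub_eq_zero, ← map_sub, ← RingHom.mem_ker, hker, Ideal.mem_span_singleton]
  rw [chiLam, toC_eq_toCHom]
  congr 1
  by_cases h0 : φ ν = 0
  · rw [h0, MulChar.map_zero, residueRep_eq_zero]
    rintro ⟨w, hw, h⟩
    rw [hmem, map_pow, h0, ← hcard, zero_pow (card_sub_one_div_pos φ h3).ne'] at h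
    have h1 := congrArg φ hw
    rw [map_pow, ← h, map_one] at h1
    norm_num at h1
  · refine residueRep_eq (fun x hx y hy h => ?_) (cubicChar_pow_three φ h3 h0) ?_
    · exact eq_of_dvd_sub (by rwa [hnorm]) (norm_toCHom_of_pow_eq_one (by norm_num) hx)
        (norm_toCHom_of_pow_eq_one (by norm_num) hy) h
    · rw [hmem, map_pow, map_cubicChar, hcard]

theorem cubicChar_map_rhoInt :
    cubicChar φ h3 (φ rhoInt) = rhoInt ^ ((Fintype.card F - 1) / 3) := by
  refine cubicChar_eq_of_map_eq φ h3 ((isPrimitiveRoot_map_rhoInt φ h3).ne_zero (by norm_num)) ?_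
    (map_pow _ _ _)
  rw [← pow_mul, mul_comm, pow_mul, isPrimitiveRoot_rhoInt.pow_eq_one, one_pow]

theorem rho_mul_conj : toCHom rhoInt * starRingEnd ℂ (toCHom rhoInt) = 1 := by
  rw [Complex.mul_conj, Complex.normSq_eq_norm_sq,
    norm_toCHom_of_pow_eq_one (n := 3) (by norm_num) isPrimitiveRoot_rhoInt.pow_eq_one]
  norm_num

/-- This is what dictates the choice of `χ₁`: the value `χ_λ(ρ) = ρ^((l-1)/3)` is `ρ²` for `l ≡ 7`
and `ρ` for `l ≡ 4` modulo `9`. In the first case `ρ²` cancels the two factors `ρ̄` from `χ̄₀` and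
`ν̄`; in the second `χ₀'(ρ) = 1` and `ρ` cancels the one from `ν̄`. -/
theorem chiOne_rhoInt_mul (hchi : ∀ ν, chiLam l lam ν = toCHom (cubicChar φ h3 (φ ν)))
    (hcard : Fintype.card F = l) (hl9 : l % 9 = 7 ∨ l % 9 = 4) (ν : 𝓞 K) :
    chiOne l lam (rhoInt * ν) * starRingEnd ℂ (toCHom (rhoInt * ν)) =
      chiOne l lam ν * starRingEnd ℂ (toCHom ν) := by
  have hrho := rho_mul_conj
  have hrho3 : toCHom rhoInt ^ 3 = 1 := by
    rw [← map_pow, isPrimitiveRoot_rhoInt.pow_eq_one, map_one]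
  have h1 : chiLam l lam (rhoInt * ν) = toCHom rhoInt ^ ((l - 1) / 3) * chiLam l lam ν := by
    rw [hchi, hchi, map_mul φ, map_mul, cubicChar_map_rhoInt, map_mul, map_pow, hcard]
  rcases hl9 with h | h
  · have hu : IsUnit rhoInt := isPrimitiveRoot_rhoInt.isUnit (by norm_num)
    have h2 : chiZero (rhoInt * ν) = toCHom rhoInt * chiZero ν := chiZero_unit_mul hu.unit ν
    have hexp : (l - 1) / 3 = 3 * (l / 9) + 2 := by omega
    rw [chiOne, chiOne, if_pos h, if_pos h, h1, h2, hexp, pow_add, pow_mul, hrho3, one_pow,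
      map_mul, map_mul, map_mul]
    linear_combination (chiLam l lam ν * starRingEnd ℂ (chiZero ν) * starRingEnd ℂ (toCHom ν)) *
      (toCHom rhoInt * starRingEnd ℂ (toCHom rhoInt) + 1) * hrho
  · have h' : ¬ l % 9 = 7 := by omega
    have hexp : (l - 1) / 3 = 3 * (l / 9) + 1 := by omega
    rw [chiOne, chiOne, if_neg h', if_pos h, if_neg h', if_pos h, h1, chiZero'_rhoInt_mul, hexp,
      pow_add, pow_mul, hrho3, one_pow, map_mul, map_mul]
    linear_combination (chiLam l lam ν * chiZero' ν * starRingEnd ℂ (toCHom ν)) * hrho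

/-- `χ_λ` is even while `χ₀` and `χ₀'` are odd; the sign is absorbed by `ν̄`. -/
theorem chiOne_neg (hchi : ∀ ν, chiLam l lam ν = toCHom (cubicChar φ h3 (φ ν))) (ν : 𝓞 K) :
    chiOne l lam (-ν) = -chiOne l lam ν := by
  have h1 : chiLam l lam (-ν) = chiLam l lam ν := by
    rw [hchi, hchi, map_neg, cubicChar_neg]
  have h2 : chiZero (-ν) = -chiZero ν := by
    have := chiZero_unit_mul (-1) ν
    rw [Units.val_neg, Units.val_one, neg_one_mul, toC_eq_toCHom, map_neg, map_one,
      neg_one_mul] at this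
    exact this
  rw [chiOne, chiOne, h1, h2, chiZero'_neg, map_neg]
  split_ifs <;> ring

/-- The Hecke character can be computed on any generator. -/
theorem heckeChar_span (hchi : ∀ ν, chiLam l lam ν = toCHom (cubicChar φ h3 (φ ν)))
    (hcard : Fintype.card F = l) (hl9 : l % 9 = 7 ∨ l % 9 = 4) (ν : 𝓞 K) :
    heckeChar l lam (Ideal.span {ν}) = chiOne l lam ν * starRingEnd ℂ (toCHom ν) := by
  have hpow : ∀ (i : ℕ) (ν : 𝓞 K),
      chiOne l lam (rhoInt ^ i * ν) * starRingEnd ℂ (toCHom (rhoInt ^ i * ν)) =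
        chiOne l lam ν * starRingEnd ℂ (toCHom ν) := by
    intro i
    induction i with
    | zero => intro ν; rw [pow_zero, one_mul]
    | succ i ih =>
      intro ν
      rw [pow_succ, mul_assoc, ih, chiOne_rhoInt_mul h3 hchi hcard hl9]
  have hneg : ∀ ν : 𝓞 K, chiOne l lam (-ν) * starRingEnd ℂ (toCHom (-ν)) =
      chiOne l lam ν * starRingEnd ℂ (toCHom ν) := by
    intro ν
    rw [chiOne_neg h3 hchi, map_neg, map_neg, neg_mul_neg]
  rw [heckeChar, toC_eq_toCHom]
  obtain ⟨u, hu⟩ := Ideal.span_singleton_eq_span_singleton.1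
    (Ideal.span_singleton_generator (Ideal.span {ν})).symm
  rw [← hu]
  obtain ⟨i, hi | hi⟩ := unit_mem u
  · rw [hi, mul_comm ν, hpow]
  · rw [hi, mul_comm ν, neg_mul, hneg, hpow]

end Characters

/-! ### Convergence of the Hecke products. -/

theorem heckeChar_norm_sq_le (l : ℕ) (lam : 𝓞 K) (I : Ideal (𝓞 K)) :
    ‖heckeChar l lam I‖ ^ 2 ≤ Ideal.absNorm I := by
  rw [heckeChar, norm_mul, RCLike.norm_conj, mul_pow, toC_eq_toCHom, norm_toCHom_sq,
    Ideal.span_singleton_generator]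
  exact mul_le_of_le_one_left (Nat.cast_nonneg _)
    (pow_le_one₀ (norm_nonneg _) (norm_chiOne_le _))

/-- Convergence of the Euler product of a function on ideals of absolute value at most `N(I)^{1/2}`. -/
theorem multipliable_heckeFactor {ψ : Ideal (𝓞 K) → ℂ}
    (hψ : ∀ I, ‖ψ I‖ ^ 2 ≤ Ideal.absNorm I) {s : ℂ} (hs : 3 / 2 < s.re) :
    Multipliable (heckeFactor ψ s) := by
  have hsum := summable_absNorm_rpow (t := s.re - 1 / 2) (by linarith)
  have hN (P : HeightOneSpectrum (𝓞 K)) : 2 ≤ Ideal.absNorm P.asIdeal :=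
    NumberField.HeightOneSpectrum.one_lt_absNorm P
  let z : HeightOneSpectrum (𝓞 K) → ℂ :=
    fun P => ψ P.asIdeal * (Ideal.absNorm P.asIdeal : ℂ) ^ (-s)
  have hz (P) : ‖z P‖ ≤ (Ideal.absNorm P.asIdeal : ℝ) ^ (-(s.re - 1 / 2)) := by
    have h0 : (0 : ℝ) < Ideal.absNorm P.asIdeal := by
      exact_mod_cast zero_lt_two.trans_le (hN P)
    have h1 : ‖ψ P.asIdeal‖ ≤ (Ideal.absNorm P.asIdeal : ℝ) ^ (1 / 2 : ℝ) := by
      rw [← Real.sqrt_eq_rpow]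
      exact Real.le_sqrt_of_sq_le (hψ _)
    rw [norm_mul, Complex.norm_natCast_cpow_of_pos (by exact_mod_cast h0), Complex.neg_re,
      show -(s.re - 1 / 2) = 1 / 2 + -s.re by ring, Real.rpow_add h0]
    exact mul_le_mul_of_nonneg_right h1 (by positivity)
  have hz2 (P) : ‖z P‖ ≤ 1 / 2 := by
    have h2 : (2 : ℝ) ≤ Ideal.absNorm P.asIdeal := by exact_mod_cast hN P
    refine (hz P).trans ?_
    calc (Ideal.absNorm P.asIdeal : ℝ) ^ (-(s.re - 1 / 2))
        ≤ (Ideal.absNorm P.asIdeal : ℝ) ^ (-1 : ℝ) :=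
          Real.rpow_le_rpow_of_exponent_le (by linarith) (by linarith)
      _ = (Ideal.absNorm P.asIdeal : ℝ)⁻¹ := Real.rpow_neg_one _
      _ ≤ 1 / 2 := by
        rw [one_div]
        exact inv_anti₀ (by norm_num) h2
  have hne (P) : 1 / 2 ≤ ‖1 - z P‖ := by
    have := norm_sub_norm_le (1 : ℂ) (z P)
    rw [norm_one] at this
    linarith [hz2 P]
  -- Since `‖z‖ ≤ 1/2`, the deviation `z / (1 - z)` of the factor from `1` is at most `2‖z‖`, which
  -- is summable.
  have hfac : heckeFactor ψ s = fun P => 1 + z P / (1 - z P) := by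
    funext P
    have h1 : 1 - z P ≠ 0 := norm_pos_iff.1 (by linarith [hne P])
    change (1 - z P)⁻¹ = _
    field_simp
    ring
  rw [hfac]
  refine multipliable_one_add_of_summable ?_
  refine (hsum.mul_left 2).of_nonneg_of_le (fun P => norm_nonneg _) fun P => ?_
  rw [norm_div, div_le_iff₀ (by linarith [hne P])]
  nlinarith [hz P, hne P, norm_nonneg (z P)]

/-! ### The curve at a prime, and the local identity. -/

section LocalFactors

variable (lam : 𝓞 K) (P : HeightOneSpectrum (𝓞 K))

/-- Completing the square: `y² = x³ + λ²/4` is isomorphic to `y² + λy = x³`. -/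
theorem exists_smul_curve_eq_cubicTwist :
    ∃ C : WeierstrassCurve.VariableChange (P.adicCompletion K),
      C • (curve lam).baseChange (P.adicCompletion K) =
        (cubicTwist (algebraMap (𝓞 K) (P.adicCompletionIntegers K) lam)).map
          (algebraMap (P.adicCompletionIntegers K) (P.adicCompletion K)) := by
  let C : WeierstrassCurve.VariableChange K := ⟨1, 0, 0, (lam : K) / 2⟩
  refine ⟨C.map (algebraMap K (P.adicCompletion K)), ?_⟩
  have hC : C • curve lam = cubicTwist (lam : K) := by
    apply WeierstrassCurve.ext <;>
      simp only [C, curve, cubicTwist, WeierstrassCurve.variableChange_def, inv_one,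
        Units.val_one] <;> ring
  rw [WeierstrassCurve.baseChange, WeierstrassCurve.map_variableChange, hC, cubicTwist_map,
    cubicTwist_map]
  rfl

variable {lam P}

/-- A factor `u¹²` moves the valuation of the discriminant by a multiple of `12`, so it never
reaches `0`. -/
theorem localPolynomial_curve_eq_one {n : ℕ} (hn : ¬ 12 ∣ n)
    (hv : P.intValuation (27 * lam ^ 4) = WithZero.exp (-n : ℤ)) :
    ((curve lam).baseChange (P.adicCompletion K)).localPolynomial
      (P.adicCompletionIntegers K) = 1 := by
  have hΔ : ((curve lam).baseChange (P.adicCompletion K)).Δ =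
      ((algebraMap (𝓞 K) (P.adicCompletionIntegers K) (-(27 * lam ^ 4)) :
        P.adicCompletionIntegers K) : P.adicCompletion K) := by
    have h : (curve lam).Δ = algebraMap (𝓞 K) K (-(27 * lam ^ 4)) := by
      simp only [curve, WeierstrassCurve.Δ, WeierstrassCurve.b₂, WeierstrassCurve.b₄,
        WeierstrassCurve.b₆, WeierstrassCurve.b₈, map_neg, map_mul, map_pow, map_ofNat]
      ring
    rw [WeierstrassCurve.baseChange, WeierstrassCurve.map_Δ, h]
    rfl
  refine localPolynomial_eq_one _ ?_ fun u r hr h => ?_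
  · rw [WeierstrassCurve.baseChange, WeierstrassCurve.map_c₄]
    simp [curve, WeierstrassCurve.c₄, WeierstrassCurve.b₂, WeierstrassCurve.b₄]
  · have h1 := congrArg Valued.v h
    have h2 : Valued.v (algebraMap (P.adicCompletionIntegers K) (P.adicCompletion K) r) = 1 :=
      HeightOneSpectrum.adicCompletionIntegers.isUnit_iff_valued_eq_one.1 hr
    rw [map_mul, map_pow, hΔ, valued_algebraMap, Valuation.map_neg, hv, h2] at h1
    have hu : Valued.v u ≠ 0 := by
      intro h0
      rw [h0, zero_pow (by norm_num), zero_mul] at h1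
      exact zero_ne_one h1
    have h4 := congrArg WithZero.log h1
    rw [WithZero.log_mul (pow_ne_zero _ hu) WithZero.exp_ne_zero, WithZero.log_pow,
      WithZero.log_exp, WithZero.log_one, nsmul_eq_mul] at h4
    push_cast at h4
    omega

end LocalFactors

/-- The hypotheses on `λ`, in terms of its residue field. -/
theorem exists_residueField {l : ℕ} (hl : l.Prime) (hl9 : l % 9 = 7 ∨ l % 9 = 4) {lam : 𝓞 K}
    (hnorm : Ideal.absNorm (Ideal.span {lam}) = l) :
    ∃ (F : Type) (_ : Field F) (_ : Fintype F) (φ : 𝓞 K →+* F), Function.Surjective φ ∧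
      RingHom.ker φ = Ideal.span {lam} ∧ Fintype.card F = l ∧ (3 : F) ≠ 0 ∧
        ∀ h3 : (3 : F) ≠ 0, ∀ ν, chiLam l lam ν = toCHom (cubicChar φ h3 (φ ν)) := by
  -- This bound keeps the cube roots of unity incongruent modulo `λ`, by `eq_of_dvd_sub`.
  have hl4 : 4 < l := by
    by_contra h
    have : l = 4 := by omega
    rw [this] at hl
    norm_num at hl
  have hprime : (Ideal.span {lam}).IsPrime :=
    Ideal.isPrime_of_irreducible_absNorm (by rw [hnorm]; exact hl)
  have hbot : Ideal.span {lam} ≠ ⊥ := by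
    intro h
    rw [h, Ideal.absNorm_bot] at hnorm
    omega
  obtain ⟨F, _, _, φ, hφ, hker⟩ := exists_finite_field_quotient hprime hbot
  have h3 : (3 : F) ≠ 0 := by
    intro h
    have h1 : lam ∣ 3 := by
      rw [← Ideal.mem_span_singleton, ← hker, RingHom.mem_ker, map_ofNat, h]
    have h2 := absNorm_dvd_of_dvd h1
    rw [hnorm, absNorm_span_three, show 9 = 3 ^ 2 by norm_num] at h2
    have h4 := (Nat.prime_dvd_prime_iff_eq hl Nat.prime_three).1 (hl.dvd_of_dvd_pow h2)
    omega
  have hcard : Fintype.card F = l := by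
    rw [← absNorm_cubicJacobi φ h3, span_cubicJacobi φ h3 hφ, hker, hnorm]
  exact ⟨F, inferInstance, inferInstance, φ, hφ, hker, hcard, h3,
    fun h3 => chiLam_eq h3 hker hcard hnorm hl4⟩

section LocalIdentity

variable {l : ℕ} {lam : 𝓞 K} {F : Type} [Field F] [Fintype F] {φ : 𝓞 K →+* F} (h3 : (3 : F) ≠ 0)

theorem heckeChar_of_ker_eq (hchi : ∀ ν, chiLam l lam ν = toCHom (cubicChar φ h3 (φ ν)))
    (hker : RingHom.ker φ = Ideal.span {lam}) (hcard : Fintype.card F = l)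
    (hl9 : l % 9 = 7 ∨ l % 9 = 4) : heckeChar l lam (Ideal.span {lam}) = 0 := by
  have h0 : φ lam = 0 := by
    rw [← RingHom.mem_ker, hker]
    exact Ideal.mem_span_singleton_self lam
  have h1 : chiLam l lam lam = 0 := by rw [hchi, h0, MulChar.map_zero, map_zero]
  rw [heckeChar_span h3 hchi hcard hl9, chiOne, h1]
  simp

theorem heckeChar_sqrtNegThree (hchi : ∀ ν, chiLam l lam ν = toCHom (cubicChar φ h3 (φ ν)))
    (hcard : Fintype.card F = l) (hl9 : l % 9 = 7 ∨ l % 9 = 4) :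
    heckeChar l lam (Ideal.span {1 + 2 * rhoInt}) = 0 := by
  rw [heckeChar_span h3 hchi hcard hl9, chiOne, chiZero_sqrtNegThree, chiZero'_sqrtNegThree]
  simp

theorem chiOne_of_three_dvd (hl9 : l % 9 = 7 ∨ l % 9 = 4) {ν : 𝓞 K} (h : (3 : 𝓞 K) ∣ ν - 1) :
    chiOne l lam ν = chiLam l lam ν := by
  rw [chiOne, chiZero_of_three_dvd h, chiZero'_of_three_dvd h, map_one, mul_one]
  rcases hl9 with h | h <;> simp [h]

/-- The Euler factors of the two `L`-functions at a prime not dividing `3λ`. -/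
theorem localPolynomial_good (hchi : ∀ ν, chiLam l lam ν = toCHom (cubicChar φ h3 (φ ν)))
    (hφ : Function.Surjective φ) (hker : RingHom.ker φ = Ideal.span {lam})
    (hcard : Fintype.card F = l) (hl : l.Prime)
    (hl9 : l % 9 = 7 ∨ l % 9 = 4) (hprimary : (3 : 𝓞 K) ∣ lam - 1)
    (P : HeightOneSpectrum (𝓞 K)) (hP3 : (3 : 𝓞 K) ∉ P.asIdeal) (hPlam : lam ∉ P.asIdeal) (x : ℂ) :
    Polynomial.aeval x (((curve lam).baseChange (P.adicCompletion K)).localPolynomial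
        (P.adicCompletionIntegers K)) =
      (1 - heckeChar l lam P.asIdeal * x) *
        (1 - starRingEnd ℂ (heckeChar l lam P.asIdeal) * x) := by
  let κ := IsLocalRing.ResidueField (P.adicCompletionIntegers K)
  have : Fintype κ := Fintype.ofFinite κ
  let φ' : 𝓞 K →+* κ := reductionHom P
  have hφ' : Function.Surjective φ' := reductionHom_surjective P
  have hker' : RingHom.ker φ' = P.asIdeal := ker_reductionHom P
  have h3' : (3 : κ) ≠ 0 := by
    intro h
    refine hP3 ?_
    rw [← hker', RingHom.mem_ker, map_ofNat, h]
  have hlam0 : φ' lam ≠ 0 := by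
    intro h
    refine hPlam ?_
    rwa [← hker', RingHom.mem_ker]
  -- The normalisation `λ ≡ 1` modulo `3` selects this generator, which is what lets reciprocity for
  -- Jacobi sums speak about `λ`.
  have hlam : lam = -cubicJacobi φ h3 :=
    eq_neg_of_span_eq hprimary (three_dvd_cubicJacobi_add_one φ h3)
      (by rw [span_cubicJacobi φ h3 hφ, hker])
  have hrec := cubicChar_reciprocity_of_prime_card h3 h3' hφ hφ' (by rwa [hcard]) (by
    rw [hker, hker']
    intro h
    exact hPlam (h ▸ Ideal.mem_span_singleton_self lam))
  set c := cubicChar φ' h3' (φ' lam) with hc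
  have hc' : cubicChar φ h3 (φ (cubicJacobi φ' h3')) = c := by
    rw [← hrec, hc, hlam, map_neg, cubicChar_neg]
  have hcube : c ^ 3 = 1 := cubicChar_pow_three φ' h3' hlam0
  set J := cubicJacobi φ' h3'
  set J' := cubicJacobiConj φ' h3'
  have hconjJ : starRingEnd ℂ (toCHom J) = toCHom J' := conj_toCHom_cubicJacobi' φ' h3'
  -- The Hecke character is computed on the generator `-J ≡ 1` modulo `3`, where `χ₁` reduces to
  -- `χ_λ`.
  have hψ : heckeChar l lam P.asIdeal = -(toCHom c * toCHom J') := by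
    rw [← hker', ← span_cubicJacobi φ' h3' hφ', ← Ideal.span_singleton_neg,
      heckeChar_span h3 hchi hcard hl9, chiOne_of_three_dvd hl9, hchi, map_neg φ, cubicChar_neg,
      hc', map_neg, map_neg, mul_neg]
    · rw [hconjJ]
    · have := three_dvd_cubicJacobi_add_one φ' h3'
      rw [← neg_add', dvd_neg]
      exact this
  have hψ' : starRingEnd ℂ (heckeChar l lam P.asIdeal) = -(toCHom c ^ 2 * toCHom J) := by
    rw [hψ, map_neg, map_mul, conj_toCHom_cubicChar, ← hconjJ, Complex.conj_conj, map_pow]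
  have hJJ : toCHom J * toCHom J' = Fintype.card κ := by
    rw [← map_mul, cubicJacobi_mul_conj, map_natCast]
  have hC3 : toCHom c ^ 3 = 1 := by rw [← map_pow, hcube, map_one]
  have hcount := congrArg toCHom (card_point_cubicTwist φ' h3' hlam0)
  simp only [map_natCast, map_add, map_mul, map_pow, map_one] at hcount
  obtain ⟨C, hC⟩ := exists_smul_curve_eq_cubicTwist lam P
  have hunit (y : 𝓞 K) (hy : φ' y ≠ 0) :
      IsUnit (algebraMap (𝓞 K) (P.adicCompletionIntegers K) y) := by
    by_contra h
    exact hy ((IsLocalRing.residue_eq_zero_iff _).2 h)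
  have hunit3 := hunit 3 (by rwa [map_ofNat])
  rw [map_ofNat] at hunit3
  rw [localPolynomial_of_cubicTwist (P.adicCompletionIntegers K) hunit3 (hunit lam hlam0) C hC]
  change Polynomial.aeval x (1 - Polynomial.C ((Nat.card κ : ℤ) + 1 -
    Nat.card (cubicTwist (φ' lam)).toAffine.Point) * Polynomial.X +
      Polynomial.C (Nat.card κ : ℤ) * Polynomial.X ^ 2) = _
  rw [hψ', hψ]
  simp only [map_add, map_sub, map_mul, map_one, map_pow, Polynomial.aeval_X, map_natCast,
    Nat.card_eq_fintype_card (α := κ)]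
  rw [hcount, ← hJJ]
  -- The linear terms already agree; `c³ = 1` turns the product of the two Hecke values into `J J̄ =
  -- #κ`.
  linear_combination (-(x ^ 2 * toCHom J * toCHom J')) * hC3

theorem ellipticFactor_eq_mul (hchi : ∀ ν, chiLam l lam ν = toCHom (cubicChar φ h3 (φ ν)))
    (hφ : Function.Surjective φ) (hker : RingHom.ker φ = Ideal.span {lam})
    (hcard : Fintype.card F = l) (hl : l.Prime)
    (hl9 : l % 9 = 7 ∨ l % 9 = 4) (hprimary : (3 : 𝓞 K) ∣ lam - 1) (s : ℂ)
    (P : HeightOneSpectrum (𝓞 K)) :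
    ellipticFactor (curve lam) s P = heckeFactor (heckeChar l lam) s P *
      heckeFactor (fun I => starRingEnd ℂ (heckeChar l lam I)) s P := by
  have hPprime := P.isPrime
  have hbad (n : ℕ) (hn : ¬ 12 ∣ n) (hψ : heckeChar l lam P.asIdeal = 0)
      (hv : P.intValuation (27 * lam ^ 4) = WithZero.exp (-n : ℤ)) :
      ellipticFactor (curve lam) s P = heckeFactor (heckeChar l lam) s P *
        heckeFactor (fun I => starRingEnd ℂ (heckeChar l lam I)) s P := by
    rw [ellipticFactor, localPolynomial_curve_eq_one hn hv, heckeFactor, heckeFactor, hψ]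
    simp
  have hcoprime (h3P : (3 : 𝓞 K) ∈ P.asIdeal) : lam ∉ P.asIdeal := by
    intro h
    obtain ⟨z, hz⟩ := hprimary
    refine hPprime.ne_top ((Ideal.eq_top_iff_one _).2 ?_)
    rw [show (1 : 𝓞 K) = lam - 3 * z by rw [← hz]; ring]
    exact P.asIdeal.sub_mem h (P.asIdeal.mul_mem_right z h3P)
  by_cases hP3 : (3 : 𝓞 K) ∈ P.asIdeal
  · have hmem : 1 + 2 * rhoInt ∈ P.asIdeal := by
      refine hPprime.mem_of_pow_mem 2 ?_
      rw [sqrtNegThree_sq]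
      exact P.asIdeal.neg_mem hP3
    have hspan : P.asIdeal = Ideal.span {1 + 2 * rhoInt} := by
      have hmax := ((Ideal.span_singleton_prime prime_sqrtNegThree.ne_zero).2
        prime_sqrtNegThree).isMaximal (by simpa using prime_sqrtNegThree.ne_zero)
      exact (hmax.eq_of_le hPprime.ne_top ((Ideal.span_singleton_le_iff_mem _).2 hmem)).symm
    -- The exponent is `6` because `27 = -(√-3)⁶` and `λ` is a unit at `√-3`.
    refine hbad 6 (by norm_num) (by rw [hspan, heckeChar_sqrtNegThree h3 hchi hcard hl9]) ?_
    have h27 : (27 : 𝓞 K) = -((1 + 2 * rhoInt) ^ 6) := by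
      rw [show 6 = 2 * 3 by norm_num, pow_mul, sqrtNegThree_sq]
      norm_num
    have hv1 : P.intValuation lam = 1 :=
      HeightOneSpectrum.intValuation_eq_one_iff.2 (hcoprime hP3)
    rw [h27, map_mul, Valuation.map_neg, map_pow, map_pow, hv1,
      P.intValuation_singleton prime_sqrtNegThree.ne_zero hspan, one_pow, mul_one,
      ← WithZero.exp_nsmul]
    rfl
  by_cases hPlam : lam ∈ P.asIdeal
  · have hmax : (Ideal.span {lam}).IsMaximal := by
      rw [← hker]
      exact RingHom.ker_isMaximal_of_surjective φ hφ
    have hspan : P.asIdeal = Ideal.span {lam} :=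
      (hmax.eq_of_le hPprime.ne_top ((Ideal.span_singleton_le_iff_mem _).2 hPlam)).symm
    have hlam0 : lam ≠ 0 := by
      rintro rfl
      exact P.ne_bot (by rw [hspan, Ideal.span_singleton_eq_bot])
    -- The exponent is `4`, from `λ⁴`, because `27` is a unit at `λ`.
    refine hbad 4 (by norm_num) (by rw [hspan, heckeChar_of_ker_eq h3 hchi hker hcard hl9]) ?_
    have hv1 : P.intValuation 3 = 1 := HeightOneSpectrum.intValuation_eq_one_iff.2 hP3
    rw [show (27 : 𝓞 K) = 3 ^ 3 by norm_num, map_mul, map_pow, map_pow, hv1,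
      P.intValuation_singleton hlam0 hspan, one_pow, one_mul, ← WithZero.exp_nsmul]
    rfl
  · rw [ellipticFactor, heckeFactor, heckeFactor, localPolynomial_good h3 hchi hφ hker hcard hl hl9
      hprimary P hP3 hPlam, mul_inv]

end LocalIdentity

/-! ### Analytic continuation and the main theorem. -/

/-- The identity theorem for the product of two continuations. -/
theorem continuation_mul_eq {L₁ L₂ L₃ : ℂ → ℂ}
    (hL : ∀ s : ℂ, 3 / 2 < s.re → L₁ s * L₂ s = L₃ s) {U : Set ℂ} {f g h : ℂ → ℂ}
    (hU : IsOpen U) (hconn : IsPreconnected U) (hsub : {s : ℂ | 3 / 2 < s.re} ⊆ U)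
    (hf : Continues L₁ U f) (hg : Continues L₂ U g) (hh : Continues L₃ U h) :
    ∀ s ∈ U, f s * g s = h s := by
  have h2 : (2 : ℂ) ∈ {s : ℂ | 3 / 2 < s.re} := by
    rw [Set.mem_ofPred_eq, Complex.re_ofNat]
    norm_num
  have hopen : IsOpen {s : ℂ | 3 / 2 < s.re} := isOpen_lt continuous_const Complex.continuous_re
  refine ((hf.1.mul hg.1).analyticOnNhd hU).eqOn_of_preconnected_of_eventuallyEq
    (hh.1.analyticOnNhd hU) hconn (hsub h2) ?_
  filter_upwards [hopen.mem_nhds h2] with s hs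
  change f s * g s = h s
  rw [hf.2 s (hsub hs) hs, hg.2 s (hsub hs) hs, hh.2 s (hsub hs) hs, hL s hs]

end EisensteinCurve

theorem proposition3p3 (l : ℕ) (hl : l.Prime) (hl9 : l % 9 = 7 ∨ l % 9 = 4)
    (lam : 𝓞 EisensteinCurve.K)
    (hnorm : EisensteinCurve.toC lam * starRingEnd ℂ (EisensteinCurve.toC lam) = (l : ℂ))
    (hprimary : (3 : 𝓞 EisensteinCurve.K) ∣ lam - 1) :
    -- the Hecke character does not depend on the generator of the ideal
    (∀ ν : 𝓞 EisensteinCurve.K,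
      EisensteinCurve.heckeChar l lam (Ideal.span {ν}) =
        EisensteinCurve.chiOne l lam ν * starRingEnd ℂ (EisensteinCurve.toC ν)) ∧
    -- in the half plane of convergence
    (∀ s : ℂ, 3 / 2 < s.re →
      Multipliable
        (EisensteinCurve.heckeFactor (EisensteinCurve.heckeChar l lam) s) ∧
      Multipliable
        (EisensteinCurve.heckeFactor
          (fun I => starRingEnd ℂ (EisensteinCurve.heckeChar l lam I)) s) ∧
      Multipliable
        (EisensteinCurve.ellipticFactor (EisensteinCurve.curve lam) s) ∧
      EisensteinCurve.heckeL (EisensteinCurve.heckeChar l lam) s *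
          EisensteinCurve.heckeL
            (fun I => starRingEnd ℂ (EisensteinCurve.heckeChar l lam I)) s =
        EisensteinCurve.ellipticL (EisensteinCurve.curve lam) s) ∧
    -- and wherever the three functions continue analytically
    (∀ (U : Set ℂ) (f g h : ℂ → ℂ), IsOpen U → IsPreconnected U →
      {s : ℂ | 3 / 2 < s.re} ⊆ U →
      EisensteinCurve.Continues
        (EisensteinCurve.heckeL (EisensteinCurve.heckeChar l lam)) U f →
      EisensteinCurve.Continues
        (EisensteinCurve.heckeL
          (fun I => starRingEnd ℂ (EisensteinCurve.heckeChar l lam I))) U g →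
      EisensteinCurve.Continues
        (EisensteinCurve.ellipticL (EisensteinCurve.curve lam)) U h →
      ∀ s ∈ U, f s * g s = h s) := by

  have hnorm' : Ideal.absNorm (Ideal.span {lam}) = l := by
    have h := EisensteinCurve.toCHom_mul_conj lam
    rw [← EisensteinCurve.toC_eq_toCHom, hnorm] at h
    exact_mod_cast h.symm
  obtain ⟨F, _, _, φ, hφ, hker, hcard, h3, hchi'⟩ :=
    EisensteinCurve.exists_residueField hl hl9 hnorm'
  have hchi := hchi' h3
  have hhalf : ∀ s : ℂ, 3 / 2 < s.re →
      Multipliable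
        (EisensteinCurve.heckeFactor (EisensteinCurve.heckeChar l lam) s) ∧
      Multipliable
        (EisensteinCurve.heckeFactor
          (fun I => starRingEnd ℂ (EisensteinCurve.heckeChar l lam I)) s) ∧
      Multipliable
        (EisensteinCurve.ellipticFactor (EisensteinCurve.curve lam) s) ∧
      EisensteinCurve.heckeL (EisensteinCurve.heckeChar l lam) s *
          EisensteinCurve.heckeL
            (fun I => starRingEnd ℂ (EisensteinCurve.heckeChar l lam I)) s =
        EisensteinCurve.ellipticL (EisensteinCurve.curve lam) s := by
    intro s hs
    have h1 := EisensteinCurve.multipliable_heckeFactor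
      (EisensteinCurve.heckeChar_norm_sq_le l lam) hs
    have h2 := EisensteinCurve.multipliable_heckeFactor
      (ψ := fun I => starRingEnd ℂ (EisensteinCurve.heckeChar l lam I))
      (fun I => by
        rw [RCLike.norm_conj]
        exact EisensteinCurve.heckeChar_norm_sq_le l lam I) hs
    have hfac : EisensteinCurve.ellipticFactor (EisensteinCurve.curve lam) s = fun P =>
        EisensteinCurve.heckeFactor (EisensteinCurve.heckeChar l lam) s P *
          EisensteinCurve.heckeFactor
            (fun I => starRingEnd ℂ (EisensteinCurve.heckeChar l lam I)) s P :=
      funext (EisensteinCurve.ellipticFactor_eq_mul h3 hchi hφ hker hcard hl hl9 hprimary s)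
    -- Convergence of the elliptic product needs no bound on `a_P`: it is the termwise product of
    -- two convergent ones.
    refine ⟨h1, h2, hfac ▸ h1.mul h2, ?_⟩
    rw [EisensteinCurve.ellipticL, hfac, h1.tprod_mul h2]
    rfl
  refine ⟨fun ν => ?_, hhalf, fun U f g h hU hconn hsub hf hg hh => ?_⟩
  · rw [EisensteinCurve.heckeChar_span h3 hchi hcard hl9, EisensteinCurve.toC_eq_toCHom]
  · exact EisensteinCurve.continuation_mul_eq (fun s hs => (hhalf s hs).2.2.2) hU hconn hsub hf hg hh
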